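/- **Logic.** Fix a set $\Pi$ of atomic formulas and a relation $s\vdash p$ ("the state $s\subseteq\Pi$ entails $p\in\Pi$"). A trace is a nonempty finite sequence $\rho=\rho_0\dots\rho_n$ with $\rho_i\subseteq\Pi$. $\mathbb B$ is the set of Boolean expressions built from $\mathit{true},\mathit{false}$ and elements of $\Pi$ with $\neg,\wedge,\vee,\to$. Past-time MTL formulas use in addition $\mathcal Y\phi$, $\mathcal O_I\phi$, $\mathcal H_I\phi$, $\phi\,\mathcal S_I\,\psi$, where $I$ is an interval $[l,u]$ of natural numbers with $l\le u$, or $[0,\infty)$ if omitted. With the usual clauses for the connectives, satisfaction at time $t$ is: $\rho\models_t p$ iff $\rho_t\vdash p$; $\rho\models_t\mathcal Y\phi$ iff $t\ne0$ and $\rho\models_{t-1}\phi$; $\rho\models_t\mathcal O_I\phi$ (resp. $\mathcal H_I\phi$) iff $\rho\models_{t_0}\phi$ for some (resp. every) $t_0\le t$ with $t-t_0\in I$; $\rho\models_t\phi\,\mathcal S_I\,\psi$ iff for some $t_0\le t$ with $t-t_0\in I$ one has $\rho\models_{t_0}\psi$ and $\rho\models_{t_1}\phi$ for all $t_0<t_1\le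 t$. Write $\rho\models\phi$ for $\rho\models_n\phi$. Abbreviate $\phi\,\mathrm{SIR}\,\psi=\phi\,\mathcal S\,(\phi\wedge\psi)$, $\phi\,\mathrm{SIO}\,\psi=\mathcal O\psi\to(\phi\,\mathcal S\,(\phi\wedge\psi))$, $\mathcal Y^m\phi=\mathcal O_{[m,m]}\phi$; and $\mathcal O_{[0,-1]}\phi=\mathit{false}$. **Requirements.** A FRETish requirement is $r=\langle\mathit{scope},\mathit{timing},\mathit{cond},\mathit{res}\rangle$ where, for $\mathit{mode},\mathit{stop}\in\mathbb B$ and $d\in\mathbb N$: the scope is $\mathit{null}$, $\mathit{in}$, $\mathit{notIn}$, $\mathit{before}$, $\mathit{after}$, $\mathit{onlyIn}$, $\mathit{onlyBefore}$ or $\mathit{onlyAfter}$ (each but $\mathit{null}$ with argument $\mathit{mode}$); the timing is $\mathit{immediately}$, $\mathit{next}$, $\mathit{always}$, $\mathit{never}$, $\mathit{eventually}$, $\mathit{within}(d)$, $\mathit{for}(d)$, $\mathit{after}(d)$, $\mathit{until}(\mathit{stop})$ or $\mathit{before}(\mathit{stop})$; $\mathit{cond}\in\mathbb B\cup\{\mathit{null}\}$;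 $\mathit{res}\in\mathbb B$. The *body* of $r$ is a Boolean combination of pairs (timing, response) not involving $\mathit{never}$ and $\mathit{after}$: it is $(\mathit{always},\neg\mathit{res})$ for $\mathit{never}$; $(\mathit{for}(d),\neg\mathit{res})\wedge(\mathit{within}(d+1),\mathit{res})$ for $\mathit{after}(d)$; and $(\mathit{timing},\mathit{res})$ otherwise. For the three "only" scopes it is replaced by its dual: each pair $(\tau,\psi)$ becomes $(\mathrm{dual}(\tau),\neg\psi)$ and $\wedge$ becomes $\vee$, where dual exchanges $\mathit{always}$ and $\mathit{eventually}$, $\mathit{within}(d)$ and $\mathit{for}(d)$, $\mathit{before}(\mathit{stop})$ and $\mathit{until}(\mathit{stop})$, and fixes $\mathit{immediately}$ and $\mathit{next}$. **Denotational semantics.** For $\psi\in\mathbb B$ let $[\![\psi]\!]_\rho$ be the list, in increasing order, of the maximal intervals of $\{i\le n:\rho\models_i\psi\}$; write $i\in[\![\psi]\!]_\rho$ if $i$ lies in one of them. Let $M=[\![\mathit{mode}]\!]_\rho$ and, if $M$ is nonempty, let $[a,b]$ be its first interval. The list of scope intervals is: $\langle[0,n]\rangle$ for $\mathit{null}$;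 $M$ for $\mathit{in}$; the list of maximal intervals of the complement of $M$ in $[0,n]$ for $\mathit{notIn}$ and $\mathit{onlyIn}$; $\langle[b+1,n]\rangle$ for $\mathit{after}$ (empty if $M$ is empty or $b=n$); $\langle[0,a-1]\rangle$ for $\mathit{before}$ (empty if $a=0$, and $\langle[0,n]\rangle$ if $M$ is empty); $\langle[0,b]\rangle$ for $\mathit{onlyAfter}$ ($\langle[0,n]\rangle$ if $M$ is empty); $\langle[a,n]\rangle$ for $\mathit{onlyBefore}$ (empty if $M$ is empty). For an interval $I=[l,u]$, the set $T$ of triggers is $\{l\}$ if $\mathit{cond}=\mathit{null}$, and otherwise $\{\max(\min J,l): J$ an interval of $[\![\mathit{cond}]\!]_\rho$ with $J\cap I\ne\emptyset\}$. Let $S=\{s\in I: s\in[\![\mathit{stop}]\!]_\rho\}$ and $\mathrm{fs}(t)=\min\{s\in S: t\le s\}$, or $u+1$ if there is no such $s$. With $R=[\![\psi]\!]_\rho$, the interval $I$ satisfies $(\tau,\psi)$ iff $T=\emptyset$ or - $\mathit{immediately}$: $t\in R$ for all $t\in T$; - $\mathit{next}$: for all $t\in T$, $t+1\in I$ implies $t+1\in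 R$; - $\mathit{always}$: $j\in R$ for all $j\in[\min T,u]$; - $\mathit{eventually}$: $j\in R$ for some $j\in[\max T,u]$; - $\mathit{within}(d)$: for all $t\in T$, $t+d\in I$ implies $t+k\in I\cap R$ for some $k\le d$; - $\mathit{for}(d)$: for all $t\in T$ and $k\le d$, $t+k\in I$ implies $t+k\in R$; - $\mathit{until}(\mathit{stop})$: for all $t\in T$, every $x$ with $t\le x<\mathrm{fs}(t)$ is in $R$; - $\mathit{before}(\mathit{stop})$: $S=\emptyset$, or for all $t\in T$, $\mathrm{fs}(t)=u+1$ or some $x$ with $t\le x<\mathrm{fs}(t)$ is in $R$. For bodies, $\wedge$ and $\vee$ are read as "and" and "or". The semantics $[\![r]\!]$ is the set of traces $\rho$ such that every scope interval satisfies the body of $r$ (so $\rho\in[\![r]\!]$ if there are no scope intervals). **Formula generation.** Let $\mathit{ftp}=\neg\mathcal Y\,\mathit{true}$, and for $m=\mathit{mode}$ let $\mathit{fim}=m\wedge(\mathit{ftp}\vee\mathcal Y\neg m)$, $\mathit{lim}=\neg m\wedge\mathcal Ym$, $\mathit{fnim}=\neg m\wedge(\mathit{ftp}\vee\mathcal Ym)$,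 $\mathit{lnim}=m\wedge\mathcal Y\neg m$, $\mathit{ffim}=\mathit{fim}\wedge(\mathit{ftp}\vee\mathcal Y\mathcal H\neg m)$, $\mathit{flim}=\mathit{lim}\wedge\mathcal Y\mathcal H\neg\mathit{lim}$. The endpoints (left $L$, right $E$) of the scopes are: $\mathit{null}$: $(\mathit{ftp},-)$; $\mathit{before}$: $(\mathit{ftp},\mathit{ffim})$; $\mathit{after}$: $(\mathit{flim},-)$; $\mathit{in}$: $(\mathit{fim},\mathit{lim})$; $\mathit{notIn}$ and $\mathit{onlyIn}$: $(\mathit{fnim},\mathit{lnim})$; $\mathit{onlyBefore}$: $(\mathit{ffim},-)$; $\mathit{onlyAfter}$: $(\mathit{ftp},\mathit{flim})$. For $c\in\mathbb B$ let $\mathit{Tr}=(c\wedge\mathcal Y\neg c)\vee(c\wedge L)$ and $\mathit{NT}=(\neg c)\,\mathrm{SIR}\,L$. The core formula of $(\tau,\psi)$, first for $\mathit{cond}=\mathit{null}$ and then for $\mathit{cond}=c\in\mathbb B$, is: - $\mathit{immediately}$: $L\to\psi$; $\ \mathit{Tr}\to\psi$. - $\mathit{next}$: $\mathcal YL\to\psi$;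 $\ \mathcal Y\mathit{Tr}\to(\psi\vee L)$. - $\mathit{always}$: $\psi$; $\ \mathit{NT}\vee(\psi\,\mathrm{SIR}\,\mathit{Tr})$. - $\mathit{eventually}$: $\neg(\neg\psi\,\mathrm{SIR}\,L)$; $\ \mathit{NT}\vee\neg(\neg\psi\,\mathrm{SIR}\,\mathit{Tr})$. - $\mathit{until}(\mathit{stop})$: $(\neg\mathit{stop}\,\mathrm{SIR}\,L)\to\psi$; $\ \mathit{NT}\vee((\neg\mathit{stop}\,\mathrm{SIR}\,\mathit{Tr})\to\psi)$. - $\mathit{before}(\mathit{stop})$: $\mathit{stop}\to(\neg L\wedge\neg\mathcal Y(\neg\psi\,\mathrm{SIR}\,L))$; $\ \mathit{stop}\to(\mathit{NT}\vee(\neg L\wedge\neg\mathit{Tr}\wedge\neg\mathcal Y(\neg\psi\,\mathrm{SIR}\,\mathit{Tr})))$. - $\mathit{for}(d)$: $\mathcal O_{[0,d]}L\to\psi$; $\ \mathcal O_{[0,d]}\mathit{Tr}\to(\mathit{NT}\vee\psi)$. - $\mathit{within}(d)$: $(\neg\psi\,\mathrm{SIR}\,L)\to\mathcal O_{[0,d-1]}L$;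 $\ \mathcal Y^d(\mathit{Tr}\wedge\neg\psi)\to\mathcal O_{[0,d-1]}(L\vee\psi)$. With core formula $C$, a pair with timing $\mathit{eventually}$ has $\mathit{base}=E\to\mathcal YC$ and $\mathit{baseLast}=\mathcal OL\to C$; any other pair has $\mathit{base}=E\to\mathcal Y(C\,\mathrm{SIO}\,L)$ and $\mathit{baseLast}=C\,\mathrm{SIO}\,L$. For bodies, $\mathit{base}$ and $\mathit{baseLast}$ are formed from those of the pairs with the same connectives $\wedge,\vee$. Finally, for the body of $r$, $\mathrm{genform}(r)$ is $\mathit{baseLast}$ if the scope has no right endpoint ($\mathit{null},\mathit{after},\mathit{onlyBefore}$), and otherwise $$\mathcal H(\mathit{base}\vee\mathit{ftp})\ \wedge\ \bigl((\neg E\,\mathrm{SIR}\,L)\to\mathit{baseLast}\bigr).$$ **Theorem.** For every FRETish requirement $r$ and every trace $\rho$, $\quad\rho\in[\![r]\!]\iff\rho\models\mathrm{genform}(r)$. -/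

import Mathlib

namespace Fret

/-! ### Intervals and ordered lists of intervals -/

/-- A closed interval `[lb, ub]` of natural numbers with `lb ≤ ub`. -/
@[ext]
structure NatInterval where
  lb : ℕ
  ub : ℕ
  le : lb ≤ ub

instance : Membership ℕ NatInterval where
  mem I x := I.lb ≤ x ∧ x ≤ I.ub

/-- An ordered list of intervals: a finite list `[a₀, b₀], …, [aₖ, bₖ]` of intervals with
`bᵢ + 1 < aᵢ₊₁`. -/
@[ext]
structure OLI where
  toList : List NatInterval
  chain : toList.IsChain (fun I J => I.ub + 1 < J.lb)

namespace OLI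

instance : Membership ℕ OLI where
  mem l x := ∃ I ∈ l.toList, x ∈ I

/-- The empty ordered list of intervals. -/
def empty : OLI := ⟨[], List.isChain_nil⟩

/-- The ordered list consisting of one interval. -/
def single (I : NatInterval) : OLI := ⟨[I], List.isChain_singleton I⟩

section ofPred
open Classical

/-- The maximal interval of points `≤ n` that starts at `a` and on which `P` holds
(for `a ≤ n` with `P a`). -/
noncomputable def run (P : ℕ → Prop) (n a : ℕ) : NatInterval where
  lb := a
  ub := max a (Nat.findGreatest (fun b => ∀ c, a ≤ c → c ≤ b → P c) n)
  le := le_max_left _ _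

/-- The points `a ≤ n` at which `P` holds but does not hold immediately before. -/
noncomputable def starts (P : ℕ → Prop) (n : ℕ) : List ℕ :=
  (List.range (n + 1)).filter (fun a => P a ∧ (a = 0 ∨ ¬ P (a - 1)))

theorem mem_starts {P : ℕ → Prop} {n a : ℕ} :
    a ∈ starts P n ↔ a ≤ n ∧ P a ∧ (a = 0 ∨ ¬ P (a - 1)) := by
  simp [starts]

theorem run_spec {P : ℕ → Prop} {n a : ℕ} (ha : a ≤ n) (hP : P a) :
    (run P n a).ub ≤ n ∧ ∀ c, a ≤ c → c ≤ (run P n a).ub → P c := by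
  have h0 : ∀ c, a ≤ c → c ≤ a → P c := fun c h1 h2 => by
    obtain rfl := le_antisymm h1 h2
    exact hP
  have h1 : a ≤ Nat.findGreatest (fun b => ∀ c, a ≤ c → c ≤ b → P c) n :=
    Nat.le_findGreatest ha h0
  have h2 : (run P n a).ub = Nat.findGreatest (fun b => ∀ c, a ≤ c → c ≤ b → P c) n :=
    max_eq_right h1
  rw [h2]
  exact ⟨Nat.findGreatest_le n,
    Nat.findGreatest_spec (P := fun b => ∀ c, a ≤ c → c ≤ b → P c) ha h0⟩

/-- The ordered list of the maximal intervals on which `P` holds, among the points `≤ n`;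
it encodes the set of all `i ≤ n` with `P i` (see `mem_ofPred`). -/
noncomputable def ofPred (P : ℕ → Prop) (n : ℕ) : OLI where
  toList := (starts P n).map (run P n)
  chain := by
    apply List.Pairwise.isChain
    rw [List.pairwise_map]
    have hs : (starts P n).Pairwise (· < ·) := List.pairwise_lt_range.filter _
    refine hs.imp_of_mem ?_
    intro a b ha hb hab
    rw [mem_starts] at ha hb
    have hspec := run_spec ha.1 ha.2.1
    have hnP : ¬ P (b - 1) := by
      rcases hb.2.2 with h | h
      · omega
      · exact h
    by_contra hcon
    have hcon' : b ≤ (run P n a).ub + 1 := not_lt.mp hcon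
    exact hnP (hspec.2 (b - 1) (by omega) (by omega))

theorem mem_ofPred {P : ℕ → Prop} {n i : ℕ} : i ∈ ofPred P n ↔ i ≤ n ∧ P i := by
  constructor
  · rintro ⟨I, hI, hi⟩
    obtain ⟨a, ha, rfl⟩ := List.mem_map.mp hI
    rw [mem_starts] at ha
    have hspec := run_spec ha.1 ha.2.1
    exact ⟨hi.2.trans hspec.1, hspec.2 i hi.1 hi.2⟩
  · rintro ⟨hin, hPi⟩
    have hex : ∃ a, a ≤ i ∧ ∀ c, a ≤ c → c ≤ i → P c := ⟨i, le_rfl, fun c h1 h2 => by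
      obtain rfl := le_antisymm h1 h2
      exact hPi⟩
    have hf := Nat.find_spec hex
    set a := Nat.find hex with ha
    refine ⟨run P n a, List.mem_map.mpr ⟨a, mem_starts.mpr ⟨hf.1.trans hin, hf.2 a le_rfl hf.1, ?_⟩,
      rfl⟩, hf.1, ?_⟩
    · by_contra hcon
      push Not at hcon
      refine Nat.find_min hex (m := a - 1) (by omega) ⟨by omega, fun c h1 h2 => ?_⟩
      rcases Nat.lt_or_ge c a with h | h
      · have : c = a - 1 := by omega
        rw [this]
        exact hcon.2
      · exact hf.2 c h h2
    · exact le_max_of_le_right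
        (Nat.le_findGreatest (P := fun b => ∀ c, a ≤ c → c ≤ b → P c) hin hf.2)

end ofPred

/-- The complement of `l` within `[0, n]`. -/
noncomputable def compl (l : OLI) (n : ℕ) : OLI := ofPred (fun x => ¬ x ∈ l) n

end OLI

/-! ### Past-time metric temporal logic -/

/-- A nonempty finite trace `ρ₀ … ρₙ` (`n = last`) of states, each a set of atomic formulas. -/
structure Trace (AP : Type*) where
  last : ℕ
  state : Fin (last + 1) → Set AP

/-- Past-time MTL formulas. The interval `none` is `[0, +∞)`. -/
inductive MTL (AP : Type*) where
  | tt : MTL AP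
  | ff : MTL AP
  | atom (p : AP) : MTL AP
  | not (φ : MTL AP) : MTL AP
  | and (φ ψ : MTL AP) : MTL AP
  | or (φ ψ : MTL AP) : MTL AP
  | imp (φ ψ : MTL AP) : MTL AP
  | prev (φ : MTL AP) : MTL AP
  | once (I : Option NatInterval) (φ : MTL AP) : MTL AP
  | hist (I : Option NatInterval) (φ : MTL AP) : MTL AP
  | since (I : Option NatInterval) (φ ψ : MTL AP) : MTL AP

/-- Membership of a distance in an optional interval, `none` being `[0, +∞)`. -/
def InBound : Option NatInterval → ℕ → Prop
  | none, _ => True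
  | some I, k => k ∈ I

/-- `Sat entails ρ φ t`: the formula `φ` holds in `ρ` at time `t`. Here `entails s p` says that the
state `s` entails the atomic formula `p` in the underlying theory. -/
def Sat {AP : Type*} (entails : Set AP → AP → Prop) (ρ : Trace AP) : MTL AP → ℕ → Prop
  | .tt, _ => True
  | .ff, _ => False
  | .atom p, t => ∃ h : t < ρ.last + 1, entails (ρ.state ⟨t, h⟩) p
  | .not φ, t => ¬ Sat entails ρ φ t
  | .and φ ψ, t => Sat entails ρ φ t ∧ Sat entails ρ ψ t
  | .or φ ψ, t => Sat entails ρ φ t ∨ Sat entails ρ ψ t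
  | .imp φ ψ, t => ¬ Sat entails ρ φ t ∨ Sat entails ρ ψ t
  | .prev φ, t => t ≠ 0 ∧ Sat entails ρ φ (t - 1)
  | .once I φ, t => ∃ t₀, t₀ ≤ t ∧ InBound I (t - t₀) ∧ Sat entails ρ φ t₀
  | .hist I φ, t => ∀ t₀, t₀ ≤ t ∧ InBound I (t - t₀) → Sat entails ρ φ t₀
  | .since I φ ψ, t => ∃ t₀, t₀ ≤ t ∧ InBound I (t - t₀) ∧ Sat entails ρ ψ t₀ ∧
      ∀ t₁, t₀ < t₁ → t₁ ≤ t → Sat entails ρ φ t₁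

/-- `ρ ⊨ φ`: the formula holds at the last state of the trace. -/
def Models {AP : Type*} (entails : Set AP → AP → Prop) (ρ : Trace AP) (φ : MTL AP) : Prop :=
  Sat entails ρ φ ρ.last

namespace MTL
variable {AP : Type*}

/-- Since-inclusive-required. -/
def sir (φ ψ : MTL AP) : MTL AP := .since none φ (.and φ ψ)

/-- Since-inclusive-optional. -/
def sio (φ ψ : MTL AP) : MTL AP := .imp (.once none ψ) (.since none φ (.and φ ψ))

/-- `φ` holds exactly `m` steps before. -/
def prevN (m : ℕ) (φ : MTL AP) : MTL AP := .once (some ⟨m, m, le_rfl⟩) φ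

/-- Once within `[0, m]`. -/
def onceUpTo (m : ℕ) (φ : MTL AP) : MTL AP := .once (some ⟨0, m, Nat.zero_le m⟩) φ

/-- Once within `[0, m - 1]`; for `m = 0` this interval is empty and the formula is false. -/
def onceBelow : ℕ → MTL AP → MTL AP
  | 0, _ => .ff
  | m + 1, φ => onceUpTo m φ

end MTL

/-! ### Requirements -/

/-- Non-temporal Boolean expressions. -/
inductive BExpr (AP : Type*) where
  | tt : BExpr AP
  | ff : BExpr AP
  | atom (p : AP) : BExpr AP
  | not (φ : BExpr AP) : BExpr AP
  | and (φ ψ : BExpr AP) : BExpr AP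
  | or (φ ψ : BExpr AP) : BExpr AP
  | imp (φ ψ : BExpr AP) : BExpr AP

/-- A Boolean expression as an MTL formula. -/
def BExpr.toMTL {AP : Type*} : BExpr AP → MTL AP
  | .tt => .tt
  | .ff => .ff
  | .atom p => .atom p
  | .not φ => .not φ.toMTL
  | .and φ ψ => .and φ.toMTL ψ.toMTL
  | .or φ ψ => .or φ.toMTL ψ.toMTL
  | .imp φ ψ => .imp φ.toMTL ψ.toMTL

/-- The eight scopes; `global` is the null scope. -/
inductive Scope (AP : Type*) where
  | global : Scope AP
  | inMode (mode : BExpr AP) : Scope AP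
  | notIn (mode : BExpr AP) : Scope AP
  | before (mode : BExpr AP) : Scope AP
  | after (mode : BExpr AP) : Scope AP
  | onlyAfter (mode : BExpr AP) : Scope AP
  | onlyBefore (mode : BExpr AP) : Scope AP
  | onlyIn (mode : BExpr AP) : Scope AP

/-- The eight timings that are not defined through other timings. -/
inductive BasicTiming (AP : Type*) where
  | immediately : BasicTiming AP
  | next : BasicTiming AP
  | always : BasicTiming AP
  | eventually : BasicTiming AP
  | within (d : ℕ) : BasicTiming AP
  | for (d : ℕ) : BasicTiming AP
  | until (stopExpr : BExpr AP) : BasicTiming AP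
  | before (stopExpr : BExpr AP) : BasicTiming AP

/-- The ten timings. -/
inductive Timing (AP : Type*) where
  | basic (τ : BasicTiming AP) : Timing AP
  | never : Timing AP
  | after (d : ℕ) : Timing AP

/-- A requirement; `cond = none` is the null condition. -/
structure Requirement (AP : Type*) where
  scope : Scope AP
  timing : Timing AP
  cond : Option (BExpr AP)
  res : BExpr AP

/-- The scopes of type "only". -/
def Scope.isOnly {AP : Type*} : Scope AP → Bool
  | .onlyAfter _ => true
  | .onlyBefore _ => true
  | .onlyIn _ => true
  | _ => false

/-- The dual of a timing. -/
def BasicTiming.dual {AP : Type*} : BasicTiming AP → BasicTiming AP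
  | .always => .eventually
  | .eventually => .always
  | .within d => .for d
  | .for d => .within d
  | .before stopExpr => .until stopExpr
  | .until stopExpr => .before stopExpr
  | .immediately => .immediately
  | .next => .next

/-- The temporal body of a requirement: a Boolean combination of pairs (timing, response).
Only the bodies produced by `Timing.body` and `Body.dual` are used. -/
inductive Body (AP : Type*) where
  | single (τ : BasicTiming AP) (res : BExpr AP) : Body AP
  | and (b₁ b₂ : Body AP) : Body AP
  | or (b₁ b₂ : Body AP) : Body AP

/-- The body of a timing and a response: `never` is `always` for the negated response, and `after d`
is `for d` for the negated response together with `within (d + 1)`. -/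
def Timing.body {AP : Type*} : Timing AP → BExpr AP → Body AP
  | .basic τ, res => .single τ res
  | .never, res => .single .always (.not res)
  | .after d, res => .and (.single (.for d) (.not res)) (.single (.within (d + 1)) res)

/-- The dual body: dual timing and negated response. -/
def Body.dual {AP : Type*} : Body AP → Body AP
  | .single τ res => .single τ.dual (.not res)
  | .and b₁ b₂ => .or b₁.dual b₂.dual
  | .or b₁ b₂ => .and b₁.dual b₂.dual

/-- The body that has to hold in every scope interval: dualized for the "only" scopes. -/
def Requirement.body {AP : Type*} (r : Requirement AP) : Body AP :=
  if r.scope.isOnly then (r.timing.body r.res).dual else r.timing.body r.res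

/-! ### Denotational semantics -/

section Semantics
variable {AP : Type*} (entails : Set AP → AP → Prop) (ρ : Trace AP)

/-- The ordered list of intervals that encodes where `ψ` holds in `ρ`. -/
noncomputable def boolSem (ψ : BExpr AP) : OLI :=
  OLI.ofPred (Sat entails ρ ψ.toMTL) ρ.last

theorem mem_boolSem {ψ : BExpr AP} {i : ℕ} :
    i ∈ boolSem entails ρ ψ ↔ i ≤ ρ.last ∧ Sat entails ρ ψ.toMTL i := OLI.mem_ofPred

/-- The interval `[a, b]` as an ordered list, empty when `b < a`. -/
def segment (a b : ℕ) : OLI :=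
  if h : a ≤ b then OLI.single ⟨a, b, h⟩ else OLI.empty

/-- The intervals in which the body of a requirement is imposed. -/
noncomputable def scopeSem : Scope AP → OLI
  | .global => segment 0 ρ.last
  | .inMode mode => boolSem entails ρ mode
  | .notIn mode => (boolSem entails ρ mode).compl ρ.last
  | .after mode =>
      match (boolSem entails ρ mode).toList with
      | [] => OLI.empty
      | J :: _ => segment (J.ub + 1) ρ.last
  | .before mode =>
      match (boolSem entails ρ mode).toList with
      | [] => segment 0 ρ.last
      | J :: _ => if J.lb = 0 then OLI.empty else segment 0 (J.lb - 1)
  | .onlyIn mode => (boolSem entails ρ mode).compl ρ.last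
  | .onlyAfter mode =>
      match (boolSem entails ρ mode).toList with
      | [] => segment 0 ρ.last
      | J :: _ => segment 0 J.ub
  | .onlyBefore mode =>
      match (boolSem entails ρ mode).toList with
      | [] => OLI.empty
      | J :: _ => segment J.lb ρ.last

/-- The triggers of a condition in the interval `I`. -/
def triggers (cond : Option (BExpr AP)) (I : NatInterval) : Set ℕ :=
  match cond with
  | none => {I.lb}
  | some c => {m | ∃ J ∈ (boolSem entails ρ c).toList, (∃ x, x ∈ J ∧ x ∈ I) ∧ m = max J.lb I.lb}

/-- The indices of `I` at which the stop condition is satisfied. -/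
def stops (stopExpr : BExpr AP) (I : NatInterval) : Set ℕ :=
  {s | s ∈ I ∧ s ∈ boolSem entails ρ stopExpr}

open Classical in
/-- The first index of `I` from `t` on at which the stop condition is satisfied, or `I.ub + 1` if
there is none. -/
noncomputable def firstStop (stopExpr : BExpr AP) (t : ℕ) (I : NatInterval) : ℕ :=
  if ∃ s ∈ stops entails ρ stopExpr I, t ≤ s then sInf {s | s ∈ stops entails ρ stopExpr I ∧ t ≤ s}
  else I.ub + 1

/-- The intervals in which the response is satisfied as the timing requires. -/
def timeSem (cond : Option (BExpr AP)) (res : BExpr AP) : BasicTiming AP → Set NatInterval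
  | .immediately =>
      {I | triggers entails ρ cond I = ∅} ∪
      {I | (triggers entails ρ cond I).Nonempty ∧
        ∀ t ∈ triggers entails ρ cond I, t ∈ boolSem entails ρ res}
  | .next =>
      {I | triggers entails ρ cond I = ∅} ∪
      {I | (triggers entails ρ cond I).Nonempty ∧
        ∀ t ∈ triggers entails ρ cond I, t + 1 ∈ I → t + 1 ∈ boolSem entails ρ res}
  | .always =>
      {I | triggers entails ρ cond I = ∅} ∪
      {I | (triggers entails ρ cond I).Nonempty ∧
        ∃ m, IsLeast (triggers entails ρ cond I) m ∧
          ∀ j, m ≤ j → j ≤ I.ub → j ∈ boolSem entails ρ res}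
  | .eventually =>
      {I | triggers entails ρ cond I = ∅} ∪
      {I | (triggers entails ρ cond I).Nonempty ∧
        ∃ m, IsGreatest (triggers entails ρ cond I) m ∧
          ∃ j, m ≤ j ∧ j ≤ I.ub ∧ j ∈ boolSem entails ρ res}
  | .within d =>
      {I | triggers entails ρ cond I = ∅} ∪
      {I | (triggers entails ρ cond I).Nonempty ∧
        ∀ t ∈ triggers entails ρ cond I, t + d ∈ I →
          ∃ k, k ≤ d ∧ t + k ∈ I ∧ t + k ∈ boolSem entails ρ res}
  | .for d =>
      {I | triggers entails ρ cond I = ∅} ∪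
      {I | (triggers entails ρ cond I).Nonempty ∧
        ∀ t ∈ triggers entails ρ cond I, ∀ k, k ≤ d →
          t + k ∈ I → t + k ∈ boolSem entails ρ res}
  | .until stopExpr =>
      {I | triggers entails ρ cond I = ∅} ∪
      {I | (triggers entails ρ cond I).Nonempty ∧
        ∀ t ∈ triggers entails ρ cond I, ∀ x, t ≤ x → x < firstStop entails ρ stopExpr t I →
          x ∈ boolSem entails ρ res}
  | .before stopExpr =>
      {I | triggers entails ρ cond I = ∅ ∨ stops entails ρ stopExpr I = ∅} ∪
      {I | (triggers entails ρ cond I).Nonempty ∧ (stops entails ρ stopExpr I).Nonempty ∧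
        ∀ t ∈ triggers entails ρ cond I,
          firstStop entails ρ stopExpr t I = I.ub + 1 ∨
          ∃ x, t ≤ x ∧ x < firstStop entails ρ stopExpr t I ∧ x ∈ boolSem entails ρ res}

/-- The intervals in which a body holds. -/
def bodySem (cond : Option (BExpr AP)) : Body AP → Set NatInterval
  | .single τ res => timeSem entails ρ cond res τ
  | .and b₁ b₂ => bodySem cond b₁ ∩ bodySem cond b₂
  | .or b₁ b₂ => bodySem cond b₁ ∪ bodySem cond b₂

end Semantics

/-- The semantics of a requirement: the traces all of whose scope intervals satisfy the body. -/
def fretSem {AP : Type*} (entails : Set AP → AP → Prop) (r : Requirement AP) : Set (Trace AP) :=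
  {ρ | ∀ I ∈ (scopeSem entails ρ r.scope).toList, I ∈ bodySem entails ρ r.cond r.body}

/-! ### Formula generation -/

section Generation
variable {AP : Type*}

/-- A point at which `cond` becomes true, or holds at the left endpoint. -/
def triggerFormula (cond : BExpr AP) (left : MTL AP) : MTL AP :=
  .or (.and cond.toMTL (.prev (.not cond.toMTL))) (.and cond.toMTL left)

/-- `cond` has not held since the left endpoint. -/
def noTriggersFormula (cond : BExpr AP) (left : MTL AP) : MTL AP :=
  .sir (.not cond.toMTL) left

/-- The core formula for the null condition. -/
def coreFormulaNull (res : BExpr AP) (left : MTL AP) : BasicTiming AP → MTL AP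
  | .immediately => .imp left res.toMTL
  | .next => .imp (.prev left) res.toMTL
  | .always => res.toMTL
  | .eventually => .not (.sir (.not res.toMTL) left)
  | .until stopExpr => .imp (.sir (.not stopExpr.toMTL) left) res.toMTL
  | .before stopExpr =>
      .imp stopExpr.toMTL (.and (.not left) (.not (.prev (.sir (.not res.toMTL) left))))
  | .for m => .imp (.onceUpTo m left) res.toMTL
  | .within m => .imp (.sir (.not res.toMTL) left) (.onceBelow m left)

/-- The core formula for a condition `cond`. -/
def coreFormulaCond (cond res : BExpr AP) (left : MTL AP) : BasicTiming AP → MTL AP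
  | .immediately => .imp (triggerFormula cond left) res.toMTL
  | .next => .imp (.prev (triggerFormula cond left)) (.or res.toMTL left)
  | .always => .or (noTriggersFormula cond left) (.sir res.toMTL (triggerFormula cond left))
  | .eventually =>
      .or (noTriggersFormula cond left)
        (.not (.sir (.not res.toMTL) (triggerFormula cond left)))
  | .until stopExpr =>
      .or (noTriggersFormula cond left)
        (.imp (.sir (.not stopExpr.toMTL) (triggerFormula cond left)) res.toMTL)
  | .before stopExpr =>
      .imp stopExpr.toMTL
        (.or (noTriggersFormula cond left)
          (.and (.and (.not left) (.not (triggerFormula cond left)))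
            (.not (.prev (.sir (.not res.toMTL) (triggerFormula cond left))))))
  | .for m =>
      .imp (.onceUpTo m (triggerFormula cond left)) (.or (noTriggersFormula cond left) res.toMTL)
  | .within m =>
      .imp (.prevN m (.and (triggerFormula cond left) (.not res.toMTL)))
        (.onceBelow m (.or left res.toMTL))

/-- The core formula. -/
def coreFormula (τ : BasicTiming AP) (cond : Option (BExpr AP)) (res : BExpr AP)
    (left : MTL AP) : MTL AP :=
  match cond with
  | none => coreFormulaNull res left τ
  | some c => coreFormulaCond c res left τ

/-- The base formula of a timing, for an interval with endpoints `left` and `right`. -/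
def baseForm (τ : BasicTiming AP) (cond : Option (BExpr AP)) (res : BExpr AP)
    (left right : MTL AP) : MTL AP :=
  match τ with
  | .eventually => .imp right (.prev (coreFormula .eventually cond res left))
  | τ => .imp right (.prev (.sio (coreFormula τ cond res left) left))

/-- The base formula of a timing, for an interval that spans to the end of the trace. -/
def baseFormLast (τ : BasicTiming AP) (cond : Option (BExpr AP)) (res : BExpr AP)
    (left : MTL AP) : MTL AP :=
  match τ with
  | .eventually => .imp (.once none left) (coreFormula .eventually cond res left)
  | τ => .sio (coreFormula τ cond res left) left

/-- The base formula of a body. -/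
def bodyBase (cond : Option (BExpr AP)) (left right : MTL AP) : Body AP → MTL AP
  | .single τ res => baseForm τ cond res left right
  | .and b₁ b₂ => .and (bodyBase cond left right b₁) (bodyBase cond left right b₂)
  | .or b₁ b₂ => .or (bodyBase cond left right b₁) (bodyBase cond left right b₂)

/-- The base formula of a body, for an interval that spans to the end of the trace. -/
def bodyBaseLast (cond : Option (BExpr AP)) (left : MTL AP) : Body AP → MTL AP
  | .single τ res => baseFormLast τ cond res left
  | .and b₁ b₂ => .and (bodyBaseLast cond left b₁) (bodyBaseLast cond left b₂)
  | .or b₁ b₂ => .or (bodyBaseLast cond left b₁) (bodyBaseLast cond left b₂)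

/-- First time point. -/
def ftp : MTL AP := .not (.prev .tt)

def fim (mode : BExpr AP) : MTL AP :=
  .and mode.toMTL (.or ftp (.prev (.not mode.toMTL)))

def lim (mode : BExpr AP) : MTL AP :=
  .and (.not mode.toMTL) (.prev mode.toMTL)

def fnim (mode : BExpr AP) : MTL AP :=
  .and (.not mode.toMTL) (.or ftp (.prev mode.toMTL))

def lnim (mode : BExpr AP) : MTL AP :=
  .and mode.toMTL (.prev (.not mode.toMTL))

def ffim (mode : BExpr AP) : MTL AP :=
  .and (fim mode) (.or ftp (.prev (.hist none (.not mode.toMTL))))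

def flim (mode : BExpr AP) : MTL AP :=
  .and (lim mode) (.prev (.hist none (.not (lim mode))))

/-- The left endpoint of a scope. -/
def Scope.left : Scope AP → MTL AP
  | .global => ftp
  | .before _ => ftp
  | .after mode => flim mode
  | .inMode mode => fim mode
  | .notIn mode => fnim mode
  | .onlyIn mode => fnim mode
  | .onlyBefore mode => ffim mode
  | .onlyAfter _ => ftp

/-- The right endpoint of a scope, undefined for the scopes that span to the end of the trace. -/
def Scope.right : Scope AP → Option (MTL AP)
  | .global => none
  | .before mode => some (ffim mode)
  | .after _ => none
  | .inMode mode => some (lim mode)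
  | .notIn mode => some (lnim mode)
  | .onlyIn mode => some (lnim mode)
  | .onlyBefore _ => none
  | .onlyAfter mode => some (flim mode)

/-- The past-time MTL formula generated for a requirement. -/
def genform (r : Requirement AP) : MTL AP :=
  match r.scope.right with
  | none => bodyBaseLast r.cond r.scope.left r.body
  | some right =>
      .and (.hist none (.or (bodyBase r.cond r.scope.left right r.body) ftp))
        (.imp (.sir (.not right) r.scope.left) (bodyBaseLast r.cond r.scope.left r.body))

end Generation

end Fret

namespace Fret

/-!
Inside a scope interval `I` the left endpoint formula holds only at `I.lb`, so the past operators
of the core formula that refer to it see nothing before `I`. A trigger formula may well hold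
before `I`; but as soon as one trigger of `I` lies at or before the current point, an earlier
witness of `SIR` or `𝒪` can be exchanged for that trigger, and if there is no such trigger then the
disjunct `NT` holds. Each core formula therefore says the same as the timing does, point by point
(only at `I.ub` for `eventually`). An interval followed by a right endpoint is evaluated at that
point, by `ℋ (base ∨ ftp)`, and the one interval that may reach the end of the trace without being
followed by a right endpoint is evaluated there by `baseLast`.
-/

/-- `I` is one of the maximal intervals of points `≤ n` on which `P` holds. -/
structure IsMaximalRun (P : ℕ → Prop) (n : ℕ) (I : NatInterval) : Prop where
  ub_le : I.ub ≤ n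
  holds : ∀ x ∈ I, P x
  lb_eq_zero_or : I.lb = 0 ∨ ¬ P (I.lb - 1)
  ub_eq_or : I.ub = n ∨ ¬ P (I.ub + 1)

section Runs
variable {P Q : ℕ → Prop} {n x : ℕ} {I J : NatInterval}

theorem NatInterval.lb_mem (I : NatInterval) : I.lb ∈ I := ⟨le_rfl, I.le⟩

theorem NatInterval.ub_mem (I : NatInterval) : I.ub ∈ I := ⟨I.le, le_rfl⟩

theorem IsMaximalRun.eq_of_mem (hI : IsMaximalRun P n I) (hJ : IsMaximalRun P n J)
    (hxI : x ∈ I) (hxJ : x ∈ J) : I = J := by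
  have bounds : ∀ {I J : NatInterval}, IsMaximalRun P n I → IsMaximalRun P n J →
      x ∈ I → x ∈ J → I.lb ≤ J.lb ∧ J.ub ≤ I.ub := by
    rintro I J hI hJ ⟨hIx, hxI⟩ ⟨hJx, hxJ⟩
    have hJn := hJ.ub_le
    constructor <;> by_contra! hlt
    · exact hI.lb_eq_zero_or.elim (by omega) fun h => h (hJ.holds _ ⟨by omega, by omega⟩)
    · exact hI.ub_eq_or.elim (by omega) fun h => h (hJ.holds _ ⟨by omega, by omega⟩)
  obtain ⟨hlb, hub⟩ := bounds hI hJ hxI hxJ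
  obtain ⟨hlb', hub'⟩ := bounds hJ hI hxJ hxI
  exact NatInterval.ext (le_antisymm hlb hlb') (le_antisymm hub' hub)

theorem isMaximalRun_congr (h : ∀ x ≤ n, P x ↔ Q x) :
    IsMaximalRun P n I ↔ IsMaximalRun Q n I := by
  have transfer : ∀ {P Q : ℕ → Prop}, (∀ x ≤ n, P x ↔ Q x) →
      IsMaximalRun P n I → IsMaximalRun Q n I := by
    intro P Q h hI
    have hub := hI.ub_le
    have hle := I.le
    refine ⟨hub, fun x hx => (h x (hx.2.trans hub)).1 (hI.holds x hx), ?_, ?_⟩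
    · exact hI.lb_eq_zero_or.imp_right (mt (h _ (by omega)).2)
    · by_cases hn : I.ub = n
      · exact .inl hn
      · exact .inr (mt (h _ (by omega)).2 (hI.ub_eq_or.resolve_left hn))
  exact ⟨transfer h, transfer fun x hx => (h x hx).symm⟩

namespace OLI

open Classical in
theorem isMaximalRun_run {a : ℕ} (ha : a ∈ starts P n) : IsMaximalRun P n (run P n a) := by
  obtain ⟨han, hPa, hstart⟩ := mem_starts.1 ha
  obtain ⟨hub, hP⟩ := run_spec han hPa
  refine ⟨hub, fun x hx => hP x hx.1 hx.2, hstart, or_iff_not_imp_left.2 fun hne hnext => ?_⟩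
  have hlonger : ∀ c, a ≤ c → c ≤ (run P n a).ub + 1 → P c := by
    intro c hac hc
    rcases hc.lt_or_eq with hlt | rfl
    · exact hP c hac (by omega)
    · exact hnext
  have hgreatest : (run P n a).ub + 1 ≤ Nat.findGreatest (fun b => ∀ c, a ≤ c → c ≤ b → P c) n :=
    Nat.le_findGreatest (by omega) hlonger
  exact absurd (hgreatest.trans (le_max_right _ _)) (Nat.not_succ_le_self _)

theorem mem_toList_ofPred : I ∈ (ofPred P n).toList ↔ IsMaximalRun P n I := by
  have isMaximalRun_of_mem : ∀ {I}, I ∈ (ofPred P n).toList → IsMaximalRun P n I := by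
    intro I hI
    obtain ⟨a, ha, rfl⟩ := List.mem_map.1 hI
    exact isMaximalRun_run ha
  refine ⟨isMaximalRun_of_mem, fun hI => ?_⟩
  obtain ⟨J, hJ, hmem⟩ := mem_ofPred.2 ⟨I.le.trans hI.ub_le, hI.holds _ I.lb_mem⟩
  exact hI.eq_of_mem (isMaximalRun_of_mem hJ) I.lb_mem hmem ▸ hJ

theorem mem_toList_compl_ofPred :
    I ∈ ((ofPred P n).compl n).toList ↔ IsMaximalRun (fun x => ¬ P x) n I := by
  rw [compl, mem_toList_ofPred]
  exact isMaximalRun_congr fun x hx => by rw [mem_ofPred, and_iff_right hx]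

theorem lb_le_of_toList_eq_cons {l : OLI} {L : List NatInterval} (h : l.toList = J :: L)
    (hx : x ∈ l) : J.lb ≤ x := by
  obtain ⟨I, hI, hxI⟩ := hx
  have : IsTrans NatInterval fun I J => I.ub + 1 < J.lb :=
    ⟨fun I J K hIJ hJK => by have := J.le; omega⟩
  have hpairwise := l.chain.pairwise
  rw [h] at hI hpairwise
  rcases List.mem_cons.1 hI with rfl | hI
  · exact hxI.1
  · have := List.rel_of_pairwise_cons hpairwise hI
    have := J.le
    have := hxI.1
    omega

end OLI

theorem exists_isMaximalRun (hx : x ≤ n) (hP : P x) : ∃ I, IsMaximalRun P n I ∧ x ∈ I := by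
  obtain ⟨I, hI, hxI⟩ := OLI.mem_ofPred.2 ⟨hx, hP⟩
  exact ⟨I, OLI.mem_toList_ofPred.1 hI, hxI⟩

/-- `I` is the first of the maximal intervals of points `≤ n` on which `P` holds. -/
structure IsFirstRun (P : ℕ → Prop) (n : ℕ) (I : NatInterval) : Prop
    extends IsMaximalRun P n I where
  lb_le : ∀ x ≤ n, P x → I.lb ≤ x

theorem OLI.isFirstRun_of_toList_ofPred_eq_cons {l : List NatInterval}
    (h : (ofPred P n).toList = I :: l) : IsFirstRun P n I where
  toIsMaximalRun := mem_toList_ofPred.1 (h ▸ List.mem_cons_self)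
  lb_le _ hx hP := lb_le_of_toList_eq_cons h (mem_ofPred.2 ⟨hx, hP⟩)

theorem OLI.not_of_toList_ofPred_eq_nil (h : (ofPred P n).toList = []) (hx : x ≤ n) : ¬ P x := by
  intro hP
  obtain ⟨I, hI, -⟩ := mem_ofPred.2 ⟨hx, hP⟩
  simp [h] at hI

/-- `P` holds at `t` but not at the preceding point, if there is one. -/
def Rises (P : ℕ → Prop) (t : ℕ) : Prop := P t ∧ (t = 0 ∨ ¬ P (t - 1))

/-- `P` fails at `t` but holds at the preceding point. -/
def Falls (P : ℕ → Prop) (t : ℕ) : Prop := ¬ P t ∧ t ≠ 0 ∧ P (t - 1)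

theorem IsFirstRun.isLeast_lb (h : IsFirstRun P n I) : IsLeast {x | P x} I.lb := by
  refine ⟨h.holds _ I.lb_mem, fun x hx => ?_⟩
  by_contra! hlt
  have := h.lb_le x (by have := I.le; have := h.ub_le; omega) hx
  omega

theorem IsFirstRun.isLeast_falls_iff (h : IsFirstRun P n I) {t : ℕ} (ht : t ≤ n) :
    IsLeast {x | Falls P x} t ↔ t = I.ub + 1 := by
  have ub_lt : ∀ {x}, x ≤ n → Falls P x → I.ub < x := by
    rintro x hx ⟨hnot, -, hpred⟩
    by_contra! hle
    have := h.lb_le _ (by omega) hpred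
    exact hnot (h.holds x ⟨by omega, hle⟩)
  have falls_of_lt : I.ub < n → Falls P (I.ub + 1) := fun hlt =>
    ⟨h.ub_eq_or.resolve_left hlt.ne, by omega, h.holds _ I.ub_mem⟩
  constructor
  · intro hleast
    have hlt := ub_lt ht hleast.1
    exact le_antisymm (hleast.2 (falls_of_lt (by omega))) hlt
  · rintro rfl
    refine ⟨falls_of_lt ht, fun x hx => ?_⟩
    by_contra! hlt
    exact absurd (ub_lt (by omega) hx) (by omega)

end Runs

/-! ### Scopes -/

/-- Within `I`, the predicate `L` singles out the left endpoint. The point before `I` is also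
excluded, because the operator `𝒴` can look back that far. -/
structure IsLeftEndpointOn (L : ℕ → Prop) (I : NatInterval) : Prop where
  iff_eq : ∀ j ∈ I, L j ↔ j = I.lb
  not_pred : I.lb ≠ 0 → ¬ L (I.lb - 1)

/-- `L` marks the left endpoints of the intervals in `l`, all contained in `[0, n]`, and `E` marks
the points right after them. An interval that reaches `n` need not be followed by such a point. -/
structure IsDelimited (L E : ℕ → Prop) (n : ℕ) (l : List NatInterval) : Prop where
  ub_le : ∀ I ∈ l, I.ub ≤ n
  left : ∀ I ∈ l, IsLeftEndpointOn L I
  not_right : ∀ I ∈ l, ∀ j ∈ I, ¬ E j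
  ub_eq_or : ∀ I ∈ l, I.ub = n ∨ E (I.ub + 1)
  exists_of_right : ∀ t < n, E (t + 1) → ∃ I ∈ l, I.ub = t
  exists_of_left : ∀ t ≤ n, L t → (∀ x ∈ Set.Icc t n, ¬ E x) → ∃ I ∈ l, I.ub = n

section Delimited
variable {L L' E E' P : ℕ → Prop} {n a b : ℕ} {I : NatInterval} {l : List NatInterval}

theorem IsLeftEndpointOn.lb (h : IsLeftEndpointOn L I) : L I.lb :=
  (h.iff_eq _ I.lb_mem).2 rfl

theorem IsDelimited.congr (h : IsDelimited L E n l) (hL : ∀ t, L' t ↔ L t) (hE : ∀ t, E' t ↔ E t) :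
    IsDelimited L' E' n l := by
  rwa [funext fun t => propext (hL t), funext fun t => propext (hE t)]

theorem isDelimited_nil (hE : ∀ t < n, ¬ E (t + 1))
    (hL : ∀ t ≤ n, L t → ∃ x ∈ Set.Icc t n, E x) : IsDelimited L E n [] where
  ub_le := by simp
  left := by simp
  not_right := by simp
  ub_eq_or := by simp
  exists_of_right t ht h := absurd h (hE t ht)
  exists_of_left t ht h hnot := by
    obtain ⟨x, hx, hEx⟩ := hL t ht h
    exact absurd hEx (hnot x hx)

theorem isDelimited_segment (hb : b ≤ n) (hab : b < n → a ≤ b) (hL : ∀ t ≤ n, L t ↔ t = a)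
    (hE : ∀ t ≤ n, E t ↔ t = b + 1) : IsDelimited L E n (segment a b).toList := by
  by_cases hle : a ≤ b
  · rw [segment, dif_pos hle]
    exact
      { ub_le := List.forall_mem_singleton.2 hb
        left := List.forall_mem_singleton.2
          ⟨fun j hj => hL j (hj.2.trans hb),
            fun (h0 : a ≠ 0) h => by have := (hL (a - 1) (by omega)).1 h; omega⟩
        not_right := List.forall_mem_singleton.2 fun j ⟨_, hj⟩ h => by
          have := (hE j (hj.trans hb)).1 h
          exact absurd hj (by simp only; omega)
        ub_eq_or := List.forall_mem_singleton.2 <|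
          hb.eq_or_lt.imp_right fun hlt => (hE _ hlt).2 rfl
        exists_of_right := fun t ht h =>
          ⟨_, List.mem_singleton_self _, by have := (hE _ ht).1 h; simp only; omega⟩
        exists_of_left := fun t ht h hnot => by
          refine ⟨_, List.mem_singleton_self _, hb.eq_or_lt.resolve_right fun hlt => ?_⟩
          exact hnot (b + 1) ⟨by have := (hL t ht).1 h; omega, hlt⟩ ((hE _ hlt).2 rfl) }
  · rw [segment, dif_neg hle]
    refine isDelimited_nil (fun t ht h => ?_) (fun t ht h => ?_)
    · have := (hE _ ht).1 h
      omega
    · have := (hL t ht).1 h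
      omega

theorem isDelimited_maximalRuns (hl : ∀ I, I ∈ l ↔ IsMaximalRun P n I) :
    IsDelimited (Rises P) (Falls P) n l where
  ub_le I hI := ((hl I).1 hI).ub_le
  left I hI := by
    have hrun := (hl I).1 hI
    refine ⟨fun j hj => ⟨fun hrise => ?_, ?_⟩, fun _ hrise => ?_⟩
    · by_contra hne
      have := hj.1
      exact hrise.2.elim (by omega) fun h => h (hrun.holds _ ⟨by omega, by have := hj.2; omega⟩)
    · rintro rfl
      exact ⟨hrun.holds _ hj, hrun.lb_eq_zero_or⟩
    · exact hrun.lb_eq_zero_or.elim (by omega) fun h => h hrise.1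
  not_right I hI j hj hfall := hfall.1 (((hl I).1 hI).holds j hj)
  ub_eq_or I hI := by
    have hrun := (hl I).1 hI
    exact hrun.ub_eq_or.imp_right fun h => ⟨h, by omega, hrun.holds _ I.ub_mem⟩
  exists_of_right t ht hfall := by
    obtain ⟨I, hI, hlb, hub⟩ := exists_isMaximalRun ht.le hfall.2.2
    refine ⟨I, (hl I).2 hI, ?_⟩
    by_contra hne
    exact hfall.1 (hI.holds _ ⟨by omega, by omega⟩)
  exists_of_left t ht hrise hnot := by
    obtain ⟨I, hI, -, hub⟩ := exists_isMaximalRun ht hrise.1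
    refine ⟨I, (hl I).2 hI, by_contra fun hn => ?_⟩
    have := hI.ub_le
    exact hnot (I.ub + 1) ⟨by omega, by omega⟩
      ⟨hI.ub_eq_or.resolve_left hn, by omega, hI.holds _ I.ub_mem⟩

theorem isLeast_setOf_iff {t : ℕ} : IsLeast {x | P x} t ↔ P t ∧ ∀ x < t, ¬ P x :=
  and_congr_right fun _ => forall_congr' fun x => by
    rw [← not_le]; exact not_imp_not.symm

end Delimited

section ScopeFormulas
variable {AP : Type*} {entails : Set AP → AP → Prop} {ρ : Trace AP} {t : ℕ}

theorem sat_ftp : Sat entails ρ ftp t ↔ t = 0 := by simp [ftp, Sat]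

theorem sat_prev_hist_not {φ : MTL AP} : Sat entails ρ (.prev (.hist none (.not φ))) t ↔
    t ≠ 0 ∧ ∀ x < t, ¬ Sat entails ρ φ x := by
  simp only [Sat, InBound, and_true]
  exact and_congr_right fun h0 => forall_congr' fun x => by rw [Nat.le_sub_one_iff_lt (by omega)]

variable {mode : BExpr AP}

theorem sat_fim : Sat entails ρ (fim mode) t ↔ Rises (Sat entails ρ mode.toMTL) t := by
  simp only [fim, Sat, sat_ftp, Rises]
  tauto

theorem sat_fnim : Sat entails ρ (fnim mode) t ↔
    Rises (fun x => ¬ Sat entails ρ mode.toMTL x) t := by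
  simp only [fnim, Sat, sat_ftp, Rises]
  tauto

theorem sat_lnim : Sat entails ρ (lnim mode) t ↔
    Falls (fun x => ¬ Sat entails ρ mode.toMTL x) t := by
  simp only [lnim, Sat, Falls, not_not]

theorem sat_ffim : Sat entails ρ (ffim mode) t ↔ IsLeast {x | Sat entails ρ mode.toMTL x} t := by
  rw [isLeast_setOf_iff]
  change (Sat entails ρ (fim mode) t ∧ (Sat entails ρ ftp t ∨
    Sat entails ρ (.prev (.hist none (.not mode.toMTL))) t)) ↔ _
  rw [sat_fim, sat_ftp, sat_prev_hist_not]
  constructor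
  · rintro ⟨hrise, rfl | ⟨-, hnot⟩⟩
    · exact ⟨hrise.1, by simp⟩
    · exact ⟨hrise.1, hnot⟩
  · rintro ⟨hmode, hnot⟩
    by_cases h0 : t = 0
    · exact ⟨⟨hmode, .inl h0⟩, .inl h0⟩
    · exact ⟨⟨hmode, .inr (hnot _ (by omega))⟩, .inr ⟨h0, hnot⟩⟩

theorem sat_flim : Sat entails ρ (flim mode) t ↔
    IsLeast {x | Falls (Sat entails ρ mode.toMTL) x} t := by
  rw [isLeast_setOf_iff]
  change (Falls _ t ∧ Sat entails ρ (.prev (.hist none (.not (lim mode)))) t) ↔ _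
  rw [sat_prev_hist_not]
  exact and_congr_right fun hfall => and_iff_right hfall.2.1

/-- `s` has a right endpoint, and its formula holds at time `t`. -/
def Scope.RightSat (entails : Set AP → AP → Prop) (ρ : Trace AP) (s : Scope AP) (t : ℕ) : Prop :=
  match s.right with
  | none => False
  | some right => Sat entails ρ right t

theorem isDelimited_global : IsDelimited (Sat entails ρ ftp) (fun _ => False) ρ.last
    (segment 0 ρ.last).toList :=
  isDelimited_segment le_rfl (by simp) (fun _ _ => sat_ftp) (by simp; omega)

theorem isDelimited_boolSem : IsDelimited (Sat entails ρ (fim mode)) (Sat entails ρ (lim mode))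
    ρ.last (boolSem entails ρ mode).toList :=
  (isDelimited_maximalRuns fun _ => OLI.mem_toList_ofPred).congr (fun _ => sat_fim) fun _ => Iff.rfl

theorem isDelimited_compl_boolSem :
    IsDelimited (Sat entails ρ (fnim mode)) (Sat entails ρ (lnim mode)) ρ.last
      ((boolSem entails ρ mode).compl ρ.last).toList :=
  (isDelimited_maximalRuns fun _ => OLI.mem_toList_compl_ofPred).congr
    (fun _ => sat_fnim) fun _ => sat_lnim

theorem IsFirstRun.sat_ffim_iff {J : NatInterval}
    (hJ : IsFirstRun (Sat entails ρ mode.toMTL) ρ.last J) :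
    Sat entails ρ (ffim mode) t ↔ t = J.lb := by
  rw [sat_ffim]
  exact ⟨fun h => h.unique hJ.isLeast_lb, fun h => h ▸ hJ.isLeast_lb⟩

theorem isDelimited_before : IsDelimited (Sat entails ρ ftp) (Sat entails ρ (ffim mode)) ρ.last
    (scopeSem entails ρ (.before mode)).toList := by
  simp only [scopeSem, boolSem]
  split
  · next hnil =>
    refine isDelimited_segment le_rfl (by simp) (fun _ _ => sat_ftp) fun t ht => ?_
    rw [sat_ffim]
    exact iff_of_false (fun h => OLI.not_of_toList_ofPred_eq_nil hnil ht h.1) (by omega)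
  · next J _ hcons =>
    have hJ := OLI.isFirstRun_of_toList_ofPred_eq_cons hcons
    have hlb : J.lb ≤ ρ.last := J.le.trans hJ.ub_le
    split
    · next h0 =>
      refine isDelimited_nil (fun t _ h => ?_) fun t ht h => ?_
      · have := hJ.sat_ffim_iff.1 h
        omega
      · exact ⟨t, ⟨le_rfl, ht⟩, hJ.sat_ffim_iff.2 (h0 ▸ sat_ftp.1 h)⟩
    · next h0 =>
      refine isDelimited_segment (by omega) (by simp) (fun _ _ => sat_ftp) fun t _ => ?_
      rw [hJ.sat_ffim_iff, Nat.sub_add_cancel (by omega)]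

theorem isDelimited_after : IsDelimited (Sat entails ρ (flim mode)) (fun _ => False) ρ.last
    (scopeSem entails ρ (.after mode)).toList := by
  simp only [scopeSem, boolSem]
  split
  · next hnil =>
    refine isDelimited_nil (by simp) fun t ht h => ?_
    exact absurd (sat_flim.1 h).1.2.2 (OLI.not_of_toList_ofPred_eq_nil hnil (by omega))
  · next J _ hcons =>
    have hJ := OLI.isFirstRun_of_toList_ofPred_eq_cons hcons
    refine isDelimited_segment le_rfl (by simp) (fun t ht => ?_) (by simp; omega)
    rw [sat_flim, hJ.isLeast_falls_iff ht]

theorem isDelimited_onlyAfter : IsDelimited (Sat entails ρ ftp) (Sat entails ρ (flim mode)) ρ.last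
    (scopeSem entails ρ (.onlyAfter mode)).toList := by
  simp only [scopeSem, boolSem]
  split
  · next hnil =>
    refine isDelimited_segment le_rfl (by simp) (fun _ _ => sat_ftp) fun t ht => ?_
    rw [sat_flim]
    exact iff_of_false
      (fun h => OLI.not_of_toList_ofPred_eq_nil hnil (by omega) h.1.2.2) (by omega)
  · next J _ hcons =>
    have hJ := OLI.isFirstRun_of_toList_ofPred_eq_cons hcons
    refine isDelimited_segment hJ.ub_le (by simp) (fun _ _ => sat_ftp) fun t ht => ?_
    rw [sat_flim, hJ.isLeast_falls_iff ht]

theorem isDelimited_onlyBefore : IsDelimited (Sat entails ρ (ffim mode)) (fun _ => False) ρ.last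
    (scopeSem entails ρ (.onlyBefore mode)).toList := by
  simp only [scopeSem, boolSem]
  split
  · next hnil =>
    refine isDelimited_nil (by simp) fun t ht h => ?_
    exact absurd (sat_ffim.1 h).1 (OLI.not_of_toList_ofPred_eq_nil hnil ht)
  · next J _ hcons =>
    have hJ := OLI.isFirstRun_of_toList_ofPred_eq_cons hcons
    exact isDelimited_segment le_rfl (fun _ => J.le.trans hJ.ub_le) (fun t _ => hJ.sat_ffim_iff)
      (by simp; omega)

theorem isDelimited_scopeSem (s : Scope AP) : IsDelimited (Sat entails ρ s.left)
    (s.RightSat entails ρ) ρ.last (scopeSem entails ρ s).toList := by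
  cases s with
  | global => exact isDelimited_global
  | inMode mode => exact isDelimited_boolSem
  | notIn mode | onlyIn mode => exact isDelimited_compl_boolSem
  | before mode => exact isDelimited_before
  | after mode => exact isDelimited_after
  | onlyAfter mode => exact isDelimited_onlyAfter
  | onlyBefore mode => exact isDelimited_onlyBefore

end ScopeFormulas

/-! ### Past operators relative to a marker -/

section Operators
variable {AP : Type*} {entails : Set AP → AP → Prop} {ρ : Trace AP} {φ ψ tr left : MTL AP}
  {I : NatInterval} {d j t : ℕ}

theorem sat_imp : Sat entails ρ (.imp φ ψ) t ↔ (Sat entails ρ φ t → Sat entails ρ ψ t) :=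
  imp_iff_not_or.symm

theorem sat_once : Sat entails ρ (.once none φ) t ↔ ∃ t₀ ≤ t, Sat entails ρ φ t₀ := by
  simp [Sat, InBound]

theorem sat_sir : Sat entails ρ (.sir φ ψ) t ↔
    ∃ t₀ ≤ t, Sat entails ρ ψ t₀ ∧ ∀ x ∈ Set.Icc t₀ t, Sat entails ρ φ x := by
  simp only [MTL.sir, Sat, InBound, true_and]
  refine exists_congr fun t₀ => and_congr_right fun hle => ?_
  constructor
  · rintro ⟨⟨hφ, hψ⟩, hafter⟩
    refine ⟨hψ, fun x hx => ?_⟩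
    rcases hx.1.eq_or_lt with rfl | hlt
    · exact hφ
    · exact hafter x hlt hx.2
  · rintro ⟨hψ, hφ⟩
    exact ⟨⟨hφ _ ⟨le_rfl, hle⟩, hψ⟩, fun x hlt hx => hφ x ⟨hlt.le, hx⟩⟩

theorem sat_onceUpTo : Sat entails ρ (.onceUpTo d φ) t ↔
    ∃ t₀ ≤ t, t ≤ t₀ + d ∧ Sat entails ρ φ t₀ := by
  refine exists_congr fun t₀ => and_congr_right fun _ => and_congr_left fun _ => ?_
  change 0 ≤ t - t₀ ∧ t - t₀ ≤ d ↔ _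
  omega

theorem sat_onceBelow : Sat entails ρ (.onceBelow d φ) t ↔
    ∃ t₀ ≤ t, t < t₀ + d ∧ Sat entails ρ φ t₀ := by
  cases d with
  | zero => exact iff_of_false id fun ⟨_, _, _, _⟩ => by omega
  | succ d =>
    rw [MTL.onceBelow, sat_onceUpTo]
    simp only [← add_assoc, Nat.lt_succ_iff]

theorem sat_prevN : Sat entails ρ (.prevN d φ) t ↔ ∃ t₀, t₀ + d = t ∧ Sat entails ρ φ t₀ := by
  simp only [MTL.prevN, Sat, ← and_assoc]
  refine exists_congr fun t₀ => and_congr_left fun _ => ?_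
  change t₀ ≤ t ∧ d ≤ t - t₀ ∧ t - t₀ ≤ d ↔ _
  omega

section Marker
variable {T : Set ℕ} (hT : ∀ t, t ∈ T ↔ t ∈ I ∧ Sat entails ρ tr t)
include hT

-- A witness before `I` can be replaced by the given element of `T`, which comes later.
theorem sat_sir_iff_of_marker (hj : j ∈ I) (hex : ∃ t ∈ T, t ≤ j) :
    Sat entails ρ (.sir φ tr) j ↔ ∃ t ∈ T, t ≤ j ∧ ∀ x ∈ Set.Icc t j, Sat entails ρ φ x := by
  rw [sat_sir]
  constructor
  · rintro ⟨t₀, hle, htr, hφ⟩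
    rcases le_or_gt I.lb t₀ with hlb | hlt
    · exact ⟨t₀, (hT _).2 ⟨⟨hlb, hle.trans hj.2⟩, htr⟩, hle, hφ⟩
    · obtain ⟨t, ht, htj⟩ := hex
      have ht₀t : t₀ ≤ t := hlt.le.trans ((hT t).1 ht).1.1
      exact ⟨t, ht, htj, fun x hx => hφ x ⟨ht₀t.trans hx.1, hx.2⟩⟩
  · rintro ⟨t, ht, htj, hφ⟩
    exact ⟨t, htj, ((hT t).1 ht).2, hφ⟩

theorem sat_onceUpTo_iff_of_marker (hj : j ∈ I) (hex : ∃ t ∈ T, t ≤ j) :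
    Sat entails ρ (.onceUpTo d tr) j ↔ ∃ t ∈ T, t ≤ j ∧ j ≤ t + d := by
  rw [sat_onceUpTo]
  constructor
  · rintro ⟨t₀, hle, hd, htr⟩
    rcases le_or_gt I.lb t₀ with hlb | hlt
    · exact ⟨t₀, (hT _).2 ⟨⟨hlb, hle.trans hj.2⟩, htr⟩, hle, hd⟩
    · obtain ⟨t, ht, htj⟩ := hex
      exact ⟨t, ht, htj, by have := ((hT t).1 ht).1.1; omega⟩
  · rintro ⟨t, ht, htj, hd⟩
    exact ⟨t, htj, hd, ((hT t).1 ht).2⟩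

end Marker

namespace IsLeftEndpointOn

theorem mem_singleton_iff (h : IsLeftEndpointOn (Sat entails ρ left) I) (t : ℕ) :
    t ∈ ({I.lb} : Set ℕ) ↔ t ∈ I ∧ Sat entails ρ left t := by
  constructor
  · rintro rfl
    exact ⟨I.lb_mem, h.lb⟩
  · exact fun ⟨ht, hleft⟩ => (h.iff_eq t ht).1 hleft

theorem sir_iff (h : IsLeftEndpointOn (Sat entails ρ left) I) (hj : j ∈ I) :
    Sat entails ρ (.sir φ left) j ↔ ∀ x ∈ Set.Icc I.lb j, Sat entails ρ φ x := by
  rw [sat_sir_iff_of_marker h.mem_singleton_iff hj ⟨_, rfl, hj.1⟩]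
  simp only [Set.mem_singleton_iff, exists_eq_left, and_iff_right hj.1]

theorem sat_once_ub (h : IsLeftEndpointOn (Sat entails ρ left) I) :
    Sat entails ρ (.once none left) I.ub :=
  sat_once.2 ⟨I.lb, I.le, h.lb⟩

theorem sio_ub_iff (h : IsLeftEndpointOn (Sat entails ρ left) I) :
    Sat entails ρ (.sio φ left) I.ub ↔ ∀ x ∈ I, Sat entails ρ φ x :=
  (sat_imp.trans (imp_iff_right h.sat_once_ub)).trans (h.sir_iff I.ub_mem)

end IsLeftEndpointOn
end Operators

/-! ### Triggers and stops -/

section Triggers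
variable {AP : Type*} {entails : Set AP → AP → Prop} {ρ : Trace AP} {I : NatInterval}
  {cond : Option (BExpr AP)} {c : BExpr AP} {left : MTL AP} {t x : ℕ}

theorem mem_of_mem_triggers (ht : t ∈ triggers entails ρ cond I) : t ∈ I := by
  cases cond with
  | none =>
    obtain rfl : t = I.lb := ht
    exact I.lb_mem
  | some c =>
    obtain ⟨J, -, ⟨x, hxJ, hxI⟩, rfl⟩ := ht
    exact ⟨le_max_right _ _, max_le (hxJ.1.trans hxI.2) I.le⟩

theorem mem_triggers_some_iff (hI : I.ub ≤ ρ.last) : t ∈ triggers entails ρ (some c) I ↔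
    t ∈ I ∧ Sat entails ρ c.toMTL t ∧ (t = I.lb ∨ ¬ Sat entails ρ c.toMTL (t - 1)) := by
  constructor
  · intro ht
    refine ⟨mem_of_mem_triggers ht, ?_⟩
    obtain ⟨J, hJ, ⟨x, hxJ, hxI⟩, rfl⟩ := ht
    have hrun := OLI.mem_toList_ofPred.1 hJ
    refine ⟨hrun.holds _ ⟨le_max_left _ _, max_le J.le (hxI.1.trans hxJ.2)⟩, ?_⟩
    rcases le_or_gt J.lb I.lb with hle | hlt
    · exact .inl (max_eq_right hle)
    · rw [max_eq_left hlt.le]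
      exact .inr (hrun.lb_eq_zero_or.resolve_left (by omega))
  · rintro ⟨ht, hc, hstart⟩
    obtain ⟨J, hJ, htJ⟩ := OLI.mem_ofPred.2 ⟨ht.2.trans hI, hc⟩
    refine ⟨J, hJ, ⟨t, htJ, ht⟩, le_antisymm ?_ (max_le htJ.1 ht.1)⟩
    by_contra! hlt
    obtain ⟨hJlt, hIlt⟩ := max_lt_iff.1 hlt
    refine hstart.elim hIlt.ne' fun hnot => hnot ?_
    exact (OLI.mem_toList_ofPred.1 hJ).holds _ ⟨by omega, by have := htJ.2; omega⟩

theorem exists_mem_triggers_some_le (hI : I.ub ≤ ρ.last) (hx : x ∈ I)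
    (hc : Sat entails ρ c.toMTL x) : ∃ t ∈ triggers entails ρ (some c) I, t ≤ x := by
  obtain ⟨J, hJ, hxJ⟩ := OLI.mem_ofPred.2 ⟨hx.2.trans hI, hc⟩
  exact ⟨_, ⟨J, hJ, ⟨x, hxJ, hx⟩, rfl⟩, max_le hxJ.1 hx.1⟩

theorem IsLeftEndpointOn.mem_triggers_some_iff_triggerFormula
    (h : IsLeftEndpointOn (Sat entails ρ left) I) (hI : I.ub ≤ ρ.last) (t : ℕ) :
    t ∈ triggers entails ρ (some c) I ↔ t ∈ I ∧ Sat entails ρ (triggerFormula c left) t := by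
  rw [mem_triggers_some_iff hI]
  refine and_congr_right fun ht => ?_
  simp only [triggerFormula, Sat, h.iff_eq t ht]
  have := ht.1
  have h0 : t ≠ I.lb → t ≠ 0 := by omega
  tauto

theorem IsLeftEndpointOn.sat_noTriggers_or_iff (h : IsLeftEndpointOn (Sat entails ρ left) I)
    (hI : I.ub ≤ ρ.last) {φ : MTL AP} {j : ℕ} (hj : j ∈ I) :
    Sat entails ρ (.or (noTriggersFormula c left) φ) j ↔
      ((∃ t ∈ triggers entails ρ (some c) I, t ≤ j) → Sat entails ρ φ j) := by
  have hno : Sat entails ρ (noTriggersFormula c left) j ↔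
      ¬ ∃ t ∈ triggers entails ρ (some c) I, t ≤ j := by
    rw [noTriggersFormula, h.sir_iff hj]
    constructor
    · rintro hnot ⟨t, ht, htj⟩
      obtain ⟨htI, hc, -⟩ := (mem_triggers_some_iff hI).1 ht
      exact hnot t ⟨htI.1, htj⟩ hc
    · intro hnone x hx hc
      obtain ⟨t, ht, htx⟩ := exists_mem_triggers_some_le hI ⟨hx.1, hx.2.trans hj.2⟩ hc
      exact hnone ⟨t, ht, htx.trans hx.2⟩
  rw [Sat, hno, imp_iff_not_or]

variable {stopExpr : BExpr AP}

theorem mem_stops_iff (hI : I.ub ≤ ρ.last) : x ∈ stops entails ρ stopExpr I ↔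
    x ∈ I ∧ Sat entails ρ stopExpr.toMTL x :=
  and_congr_right fun hx => (mem_boolSem entails ρ).trans (and_iff_right (hx.2.trans hI))

theorem lt_firstStop_iff (hI : I.ub ≤ ρ.last) (ht : I.lb ≤ t) :
    x < firstStop entails ρ stopExpr t I ↔
      x ≤ I.ub ∧ ∀ s ∈ Set.Icc t x, ¬ Sat entails ρ stopExpr.toMTL s := by
  have not_sat (hlt : ∀ s ∈ stops entails ρ stopExpr I, t ≤ s → x < s) (hx : x ≤ I.ub) :
      ∀ s ∈ Set.Icc t x, ¬ Sat entails ρ stopExpr.toMTL s := fun s hs hstopSat =>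
    (hlt s ((mem_stops_iff hI).2 ⟨⟨ht.trans hs.1, hs.2.trans hx⟩, hstopSat⟩) hs.1).not_ge hs.2
  rw [firstStop]
  split
  · next hex =>
    obtain ⟨hmem, hle⟩ := Nat.sInf_mem (s := {s | s ∈ stops entails ρ stopExpr I ∧ t ≤ s}) hex
    obtain ⟨hinI, hstopSat⟩ := (mem_stops_iff hI).1 hmem
    constructor
    · intro hx
      have hxub := hx.le.trans hinI.2
      exact ⟨hxub, not_sat (fun s hs hts => hx.trans_le (Nat.sInf_le ⟨hs, hts⟩)) hxub⟩
    · rintro ⟨-, hnot⟩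
      by_contra! hge
      exact hnot _ ⟨hle, hge⟩ hstopSat
  · next hnone =>
    rw [Nat.lt_succ_iff]
    refine ⟨fun hx => ⟨hx, not_sat (fun s hs hts => absurd ⟨s, hs, hts⟩ hnone) hx⟩, And.left⟩

theorem firstStop_le : firstStop entails ρ stopExpr t I ≤ I.ub + 1 := by
  rw [firstStop]
  split
  · next hex =>
    have hmem := Nat.sInf_mem (s := {s | s ∈ stops entails ρ stopExpr I ∧ t ≤ s}) hex
    exact hmem.1.1.2.trans (Nat.le_succ _)
  · exact le_rfl

end Triggers

/-! ### Timings, pointwise -/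

section Timings
variable {AP : Type*} {entails : Set AP → AP → Prop} {ρ : Trace AP} {I : NatInterval}
  {cond : Option (BExpr AP)} {res stopExpr : BExpr AP} {d j : ℕ}

theorem eq_empty_or_nonempty_and_forall_iff {T : Set ℕ} {p : ℕ → Prop} :
    (T = ∅ ∨ T.Nonempty ∧ ∀ t ∈ T, p t) ↔ ∀ t ∈ T, p t := by
  rcases T.eq_empty_or_nonempty with rfl | hT
  · simp
  · simp [hT, hT.ne_empty]

theorem mem_boolSem_of_mem (hI : I.ub ≤ ρ.last) (hj : j ∈ I) :
    j ∈ boolSem entails ρ res ↔ Sat entails ρ res.toMTL j :=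
  (mem_boolSem entails ρ).trans (and_iff_right (hj.2.trans hI))

theorem mem_timeSem_immediately_iff (hI : I.ub ≤ ρ.last) :
    I ∈ timeSem entails ρ cond res .immediately ↔
      ∀ t ∈ triggers entails ρ cond I, Sat entails ρ res.toMTL t := by
  refine eq_empty_or_nonempty_and_forall_iff.trans (forall₂_congr fun t ht => ?_)
  exact mem_boolSem_of_mem hI (mem_of_mem_triggers ht)

theorem mem_timeSem_next_iff (hI : I.ub ≤ ρ.last) :
    I ∈ timeSem entails ρ cond res .next ↔
      ∀ t ∈ triggers entails ρ cond I, t + 1 ∈ I → Sat entails ρ res.toMTL (t + 1) :=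
  eq_empty_or_nonempty_and_forall_iff.trans <|
    forall₂_congr fun _ _ => forall_congr' fun hsucc => mem_boolSem_of_mem hI hsucc

theorem mem_timeSem_always_iff (hI : I.ub ≤ ρ.last) :
    I ∈ timeSem entails ρ cond res .always ↔
      ∀ t ∈ triggers entails ρ cond I, ∀ j ∈ Set.Icc t I.ub, Sat entails ρ res.toMTL j := by
  constructor
  · rintro (hempty | ⟨-, m, hm, hres⟩) t ht j hj
    · exact absurd (hempty ▸ ht) (Set.notMem_empty t)
    · exact ((mem_boolSem entails ρ).1 (hres j ((hm.2 ht).trans hj.1) hj.2)).2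
  · intro hres
    refine (Set.eq_empty_or_nonempty _).imp id fun hT => ?_
    have hmin := Nat.sInf_mem hT
    exact ⟨hT, _, ⟨hmin, fun _ => Nat.sInf_le⟩, fun j hmj hj =>
      (mem_boolSem entails ρ).2 ⟨hj.trans hI, hres _ hmin j ⟨hmj, hj⟩⟩⟩

theorem mem_timeSem_eventually_iff (hI : I.ub ≤ ρ.last) :
    I ∈ timeSem entails ρ cond res .eventually ↔
      ∀ t ∈ triggers entails ρ cond I, ∃ j ∈ Set.Icc t I.ub, Sat entails ρ res.toMTL j := by
  constructor
  · rintro (hempty | ⟨-, m, hm, j, hmj, hj, hres⟩) t ht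
    · exact absurd (hempty ▸ ht) (Set.notMem_empty t)
    · exact ⟨j, ⟨(hm.2 ht).trans hmj, hj⟩, ((mem_boolSem entails ρ).1 hres).2⟩
  · intro hres
    have hbdd : BddAbove (triggers entails ρ cond I) :=
      ⟨I.ub, fun t ht => (mem_of_mem_triggers ht).2⟩
    refine (Set.eq_empty_or_nonempty _).imp id fun hT => ?_
    have hmax := Nat.sSup_mem hT hbdd
    obtain ⟨j, hj, hSat⟩ := hres _ hmax
    exact ⟨hT, _, ⟨hmax, fun _ => le_csSup hbdd⟩, j, hj.1, hj.2,
      (mem_boolSem entails ρ).2 ⟨hj.2.trans hI, hSat⟩⟩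

theorem mem_timeSem_within_iff (hI : I.ub ≤ ρ.last) :
    I ∈ timeSem entails ρ cond res (.within d) ↔ ∀ t ∈ triggers entails ρ cond I,
      t + d ∈ I → ∃ j ∈ Set.Icc t (t + d), Sat entails ρ res.toMTL j := by
  refine eq_empty_or_nonempty_and_forall_iff.trans <|
    forall₂_congr fun t ht => forall_congr' fun hd => ⟨?_, ?_⟩
  · rintro ⟨k, hk, -, hres⟩
    exact ⟨t + k, ⟨by omega, by omega⟩, ((mem_boolSem entails ρ).1 hres).2⟩
  · rintro ⟨j, ⟨htj, hjd⟩, hres⟩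
    obtain ⟨k, rfl⟩ := Nat.exists_eq_add_of_le htj
    have hmem : t + k ∈ I := ⟨(mem_of_mem_triggers ht).1.trans htj, hjd.trans hd.2⟩
    exact ⟨k, by omega, hmem, (mem_boolSem_of_mem hI hmem).2 hres⟩

theorem mem_timeSem_for_iff (hI : I.ub ≤ ρ.last) :
    I ∈ timeSem entails ρ cond res (.for d) ↔ ∀ t ∈ triggers entails ρ cond I,
      ∀ j ∈ I, t ≤ j → j ≤ t + d → Sat entails ρ res.toMTL j := by
  refine eq_empty_or_nonempty_and_forall_iff.trans (forall₂_congr fun t _ => ⟨?_, ?_⟩)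
  · intro hres j hj htj hjd
    obtain ⟨k, rfl⟩ := Nat.exists_eq_add_of_le htj
    exact ((mem_boolSem entails ρ).1 (hres k (by omega) hj)).2
  · intro hres k hk hmem
    exact (mem_boolSem_of_mem hI hmem).2 (hres _ hmem (by omega) (by omega))

theorem mem_timeSem_until_iff (hI : I.ub ≤ ρ.last) :
    I ∈ timeSem entails ρ cond res (.until stopExpr) ↔ ∀ t ∈ triggers entails ρ cond I,
      ∀ j ∈ Set.Icc t I.ub, (∀ s ∈ Set.Icc t j, ¬ Sat entails ρ stopExpr.toMTL s) →
        Sat entails ρ res.toMTL j := by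
  refine eq_empty_or_nonempty_and_forall_iff.trans (forall₂_congr fun t ht => ?_)
  have hlt {x} := lt_firstStop_iff (entails := entails) (stopExpr := stopExpr) (x := x) hI
    (mem_of_mem_triggers ht).1
  constructor
  · intro hres j hj hnot
    exact ((mem_boolSem entails ρ).1 (hres j hj.1 (hlt.2 ⟨hj.2, hnot⟩))).2
  · intro hres x htx hx
    obtain ⟨hxub, hnot⟩ := hlt.1 hx
    exact (mem_boolSem entails ρ).2 ⟨hxub.trans hI, hres x ⟨htx, hxub⟩ hnot⟩

theorem mem_timeSem_before_iff_firstStop :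
    I ∈ timeSem entails ρ cond res (.before stopExpr) ↔
      ∀ t ∈ triggers entails ρ cond I, firstStop entails ρ stopExpr t I = I.ub + 1 ∨
        ∃ x, t ≤ x ∧ x < firstStop entails ρ stopExpr t I ∧ x ∈ boolSem entails ρ res := by
  constructor
  · rintro ((hempty | hempty) | ⟨-, -, h⟩) t ht
    · exact absurd (hempty ▸ ht) (Set.notMem_empty t)
    · exact .inl (if_neg fun ⟨s, hs, _⟩ => by rw [hempty] at hs; exact hs)
    · exact h t ht
  · intro h
    rcases Set.eq_empty_or_nonempty (triggers entails ρ cond I) with hT | hT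
    · exact .inl (.inl hT)
    · exact (Set.eq_empty_or_nonempty (stops entails ρ stopExpr I)).elim
        (fun hS => .inl (.inr hS)) fun hS => .inr ⟨hT, hS, h⟩

theorem mem_timeSem_before_iff (hI : I.ub ≤ ρ.last) :
    I ∈ timeSem entails ρ cond res (.before stopExpr) ↔ ∀ t ∈ triggers entails ρ cond I,
      ∀ s ∈ Set.Icc t I.ub, Sat entails ρ stopExpr.toMTL s →
        ∃ j ∈ Set.Ico t s, Sat entails ρ res.toMTL j := by
  rw [mem_timeSem_before_iff_firstStop]
  refine forall₂_congr fun t ht => ?_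
  have hlt {x} := lt_firstStop_iff (entails := entails) (stopExpr := stopExpr) (x := x) hI
    (mem_of_mem_triggers ht).1
  constructor
  · intro h s hs hstopSat
    have hfirst_le : firstStop entails ρ stopExpr t I ≤ s :=
      not_lt.1 fun hsf => (hlt.1 hsf).2 s ⟨hs.1, le_rfl⟩ hstopSat
    rcases h with hlast | ⟨x, htx, hx, hres⟩
    · have := hs.2
      omega
    · exact ⟨x, ⟨htx, hx.trans_le hfirst_le⟩, ((mem_boolSem entails ρ).1 hres).2⟩
  · intro h
    refine firstStop_le.eq_or_lt.imp_right fun hub => ?_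
    obtain ⟨s, hs, hstopSat⟩ : ∃ s ∈ Set.Icc t (firstStop entails ρ stopExpr t I),
        Sat entails ρ stopExpr.toMTL s := by
      by_contra! hnot
      exact lt_irrefl _ (hlt.2 ⟨Nat.lt_succ_iff.1 hub, hnot⟩)
    obtain ⟨j, hj, hres⟩ := h s ⟨hs.1, hs.2.trans (Nat.lt_succ_iff.1 hub)⟩ hstopSat
    have hjf := hj.2.trans_le hs.2
    exact ⟨j, hj.1, hjf, (mem_boolSem entails ρ).2 ⟨(hlt.1 hjf).1.trans hI, hres⟩⟩

end Timings

/-! ### Core formulas -/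

section TriggerFormula
variable {AP : Type*} {entails : Set AP → AP → Prop} {ρ : Trace AP} {I : NatInterval}
  {cond : Option (BExpr AP)} {res stopExpr : BExpr AP} {d : ℕ} {tr : MTL AP}
  (hI : I.ub ≤ ρ.last)
  (htr : ∀ t, t ∈ triggers entails ρ cond I ↔ t ∈ I ∧ Sat entails ρ tr t)
include hI htr

theorem mem_timeSem_immediately_iff_sat :
    I ∈ timeSem entails ρ cond res .immediately ↔
      ∀ j ∈ I, Sat entails ρ (.imp tr res.toMTL) j := by
  simp only [mem_timeSem_immediately_iff hI, htr, and_imp, sat_imp]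

theorem mem_timeSem_next_iff_sat :
    I ∈ timeSem entails ρ cond res .next ↔
      ∀ j ∈ I, j ≠ I.lb → Sat entails ρ (.imp (.prev tr) res.toMTL) j := by
  rw [mem_timeSem_next_iff hI]
  constructor
  · intro hres j hj hne
    have hlt := hj.1.lt_of_ne' hne
    have hpred : j - 1 ∈ I := ⟨Nat.le_sub_one_of_lt hlt, (Nat.sub_le _ _).trans hj.2⟩
    have hsucc : j - 1 + 1 = j := Nat.sub_add_cancel (Nat.one_le_of_lt hlt)
    refine sat_imp.2 fun hprev => hsucc ▸ hres (j - 1) ((htr _).2 ⟨hpred, hprev.2⟩) ?_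
    rwa [hsucc]
  · intro hres t ht hsucc
    obtain ⟨htI, hSat⟩ := (htr t).1 ht
    exact sat_imp.1 (hres (t + 1) hsucc (Nat.lt_succ_of_le htI.1).ne') ⟨t.succ_ne_zero, hSat⟩

theorem mem_timeSem_always_iff_sat :
    I ∈ timeSem entails ρ cond res .always ↔
      ∀ j ∈ I, (∃ t ∈ triggers entails ρ cond I, t ≤ j) → Sat entails ρ (.sir res.toMTL tr) j := by
  rw [mem_timeSem_always_iff hI]
  constructor
  · intro hres j hj ⟨t, ht, htj⟩
    exact (sat_sir_iff_of_marker htr hj ⟨t, ht, htj⟩).2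
      ⟨t, ht, htj, fun x hx => hres t ht x ⟨hx.1, hx.2.trans hj.2⟩⟩
  · intro hsir t ht j hj
    have hjI : j ∈ I := ⟨(mem_of_mem_triggers ht).1.trans hj.1, hj.2⟩
    obtain ⟨t₀, hle, -, hres⟩ := sat_sir.1 (hsir j hjI ⟨t, ht, hj.1⟩)
    exact hres j ⟨hle, le_rfl⟩

theorem mem_timeSem_eventually_iff_sat :
    I ∈ timeSem entails ρ cond res .eventually ↔
      ((∃ t ∈ triggers entails ρ cond I, t ≤ I.ub) →
        Sat entails ρ (.not (.sir (.not res.toMTL) tr)) I.ub) := by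
  rw [mem_timeSem_eventually_iff hI]
  constructor
  · intro hres hex hsir
    obtain ⟨t, ht, -, hnot⟩ := (sat_sir_iff_of_marker htr I.ub_mem hex).1 hsir
    obtain ⟨j, hj, hSat⟩ := hres t ht
    exact hnot j hj hSat
  · intro hsir t ht
    have hle := (mem_of_mem_triggers ht).2
    by_contra! hnot
    exact hsir ⟨t, ht, hle⟩ (sat_sir.2 ⟨t, hle, ((htr t).1 ht).2, hnot⟩)

theorem mem_timeSem_for_iff_sat :
    I ∈ timeSem entails ρ cond res (.for d) ↔ ∀ j ∈ I, (∃ t ∈ triggers entails ρ cond I, t ≤ j) →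
      Sat entails ρ (.imp (.onceUpTo d tr) res.toMTL) j := by
  rw [mem_timeSem_for_iff hI]
  constructor
  · intro hres j hj hex
    rw [sat_imp, sat_onceUpTo_iff_of_marker htr hj hex]
    exact fun ⟨t, ht, htj, hjd⟩ => hres t ht j hj htj hjd
  · intro hres t ht j hj htj hjd
    exact sat_imp.1 (hres j hj ⟨t, ht, htj⟩) (sat_onceUpTo.2 ⟨t, htj, hjd, ((htr t).1 ht).2⟩)

theorem mem_timeSem_until_iff_sat :
    I ∈ timeSem entails ρ cond res (.until stopExpr) ↔
      ∀ j ∈ I, (∃ t ∈ triggers entails ρ cond I, t ≤ j) →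
        Sat entails ρ (.imp (.sir (.not stopExpr.toMTL) tr) res.toMTL) j := by
  rw [mem_timeSem_until_iff hI]
  constructor
  · intro hres j hj hex
    rw [sat_imp, sat_sir_iff_of_marker htr hj hex]
    exact fun ⟨t, ht, htj, hnot⟩ => hres t ht j ⟨htj, hj.2⟩ hnot
  · intro hres t ht j hj hnot
    have hjI : j ∈ I := ⟨(mem_of_mem_triggers ht).1.trans hj.1, hj.2⟩
    exact sat_imp.1 (hres j hjI ⟨t, ht, hj.1⟩) (sat_sir.2 ⟨t, hj.1, ((htr t).1 ht).2, hnot⟩)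

theorem mem_timeSem_before_iff_sat :
    I ∈ timeSem entails ρ cond res (.before stopExpr) ↔
      ∀ j ∈ I, Sat entails ρ stopExpr.toMTL j → (∃ t ∈ triggers entails ρ cond I, t ≤ j) →
        Sat entails ρ (.and (.not tr) (.not (.prev (.sir (.not res.toMTL) tr)))) j := by
  rw [mem_timeSem_before_iff hI]
  constructor
  · rintro hres j hj hstopSat ⟨t, ht, htj⟩
    have hlt : t < j := by
      obtain ⟨x, hx, -⟩ := hres t ht j ⟨htj, hj.2⟩ hstopSat
      exact hx.1.trans_lt hx.2
    refine ⟨fun htrj => ?_, fun hprev => ?_⟩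
    · obtain ⟨x, hx, -⟩ := hres j ((htr j).2 ⟨hj, htrj⟩) j ⟨le_rfl, hj.2⟩ hstopSat
      exact (hx.1.trans_lt hx.2).false
    · have htpred : t ≤ j - 1 := Nat.le_sub_one_of_lt hlt
      have hpred : j - 1 ∈ I :=
        ⟨(mem_of_mem_triggers ht).1.trans htpred, (Nat.sub_le _ _).trans hj.2⟩
      obtain ⟨s, hs, hsj, hnot⟩ :=
        (sat_sir_iff_of_marker htr hpred ⟨t, ht, htpred⟩).1 hprev.2
      obtain ⟨x, hx, hSat⟩ := hres s hs j ⟨hsj.trans (Nat.sub_le _ _), hj.2⟩ hstopSat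
      exact hnot x ⟨hx.1, Nat.le_sub_one_of_lt hx.2⟩ hSat
  · intro hSat t ht j hj hstopSat
    obtain ⟨htI, htrt⟩ := (htr t).1 ht
    obtain ⟨htrj, hprev⟩ := hSat j ⟨htI.1.trans hj.1, hj.2⟩ hstopSat ⟨t, ht, hj.1⟩
    have hlt : t < j := hj.1.lt_of_ne (by rintro rfl; exact htrj htrt)
    by_contra! hnot
    exact hprev ⟨by omega, sat_sir.2 ⟨t, Nat.le_sub_one_of_lt hlt, htrt,
      fun x hx => hnot x ⟨hx.1, by have := hx.2; omega⟩⟩⟩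

end TriggerFormula

section CoreFormula
variable {AP : Type*} {entails : Set AP → AP → Prop} {ρ : Trace AP} {I : NatInterval}
  {c res : BExpr AP} {d : ℕ} {left : MTL AP} {τ : BasicTiming AP}

theorem mem_timeSem_none_within_iff (h : IsLeftEndpointOn (Sat entails ρ left) I)
    (hI : I.ub ≤ ρ.last) : I ∈ timeSem entails ρ none res (.within d) ↔
      ∀ j ∈ I, Sat entails ρ (coreFormulaNull res left (.within d)) j := by
  rw [mem_timeSem_within_iff hI]
  change (∀ t ∈ ({I.lb} : Set ℕ), _) ↔ _
  simp only [Set.mem_singleton_iff, forall_eq]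
  constructor
  · intro hres j hj
    refine sat_imp.2 fun hsir => sat_onceBelow.2 ⟨I.lb, hj.1, ?_, h.lb⟩
    by_contra! hle
    obtain ⟨x, hx, hSat⟩ := hres ⟨Nat.le_add_right _ _, hle.trans hj.2⟩
    exact (h.sir_iff hj).1 hsir x ⟨hx.1, hx.2.trans hle⟩ hSat
  · intro hcore hd
    by_contra! hnot
    obtain ⟨t, hle, hlt, hleft⟩ := sat_onceBelow.1 (sat_imp.1 (hcore _ hd) ((h.sir_iff hd).2 hnot))
    have htI : t ∈ I := ⟨by omega, hle.trans hd.2⟩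
    have := (h.iff_eq t htI).1 hleft
    omega

theorem mem_timeSem_some_within_iff (h : IsLeftEndpointOn (Sat entails ρ left) I)
    (hI : I.ub ≤ ρ.last) : I ∈ timeSem entails ρ (some c) res (.within d) ↔
      ∀ j ∈ I, Sat entails ρ (coreFormulaCond c res left (.within d)) j := by
  have htr := h.mem_triggers_some_iff_triggerFormula (c := c) hI
  rw [mem_timeSem_within_iff hI]
  constructor
  · intro hres j hj
    refine sat_imp.2 fun hprev => ?_
    obtain ⟨t, rfl, htrt, hnot⟩ := sat_prevN.1 hprev
    rw [sat_onceBelow]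
    rcases lt_or_ge t I.lb with hlt | hle
    · exact ⟨I.lb, hj.1, by omega, .inl h.lb⟩
    · have htI : t ∈ I := ⟨hle, (Nat.le_add_right _ _).trans hj.2⟩
      obtain ⟨x, hx, hSat⟩ := hres t ((htr t).2 ⟨htI, htrt⟩) hj
      have hlt : t < x := hx.1.lt_of_ne (by rintro rfl; exact hnot hSat)
      exact ⟨x, hx.2, by omega, .inr hSat⟩
  · intro hcore t ht hd
    obtain ⟨htI, htrt⟩ := (htr t).1 ht
    by_contra! hnot
    have hrest := hnot t ⟨le_rfl, Nat.le_add_right _ _⟩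
    obtain ⟨x, hle, hlt, hx⟩ :=
      sat_onceBelow.1 (sat_imp.1 (hcore _ hd) (sat_prevN.2 ⟨t, rfl, htrt, hrest⟩))
    have hxt : t < x := by omega
    refine hx.elim (fun hleft => ?_) (hnot x ⟨hxt.le, hle⟩)
    have := (h.iff_eq x ⟨htI.1.trans hxt.le, hle.trans hd.2⟩).1 hleft
    have := htI.1
    omega

theorem mem_timeSem_none_iff (h : IsLeftEndpointOn (Sat entails ρ left) I) (hI : I.ub ≤ ρ.last)
    (hτ : τ ≠ .eventually) : I ∈ timeSem entails ρ none res τ ↔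
      ∀ j ∈ I, Sat entails ρ (coreFormulaNull res left τ) j := by
  have htr : ∀ t, t ∈ triggers entails ρ none I ↔ t ∈ I ∧ Sat entails ρ left t :=
    h.mem_singleton_iff
  have hex : ∀ j ∈ I, ∃ t ∈ triggers entails ρ none I, t ≤ j := fun j hj => ⟨I.lb, rfl, hj.1⟩
  match τ, hτ with
  | .immediately, _ => exact mem_timeSem_immediately_iff_sat hI htr
  | .next, _ =>
    refine (mem_timeSem_next_iff_sat hI htr).trans (forall₂_congr fun j hj => ?_)
    refine ⟨fun hne => ?_, fun hcore _ => hcore⟩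
    by_cases hlb : j = I.lb
    · subst hlb
      exact sat_imp.2 fun hprev => absurd hprev.2 (h.not_pred hprev.1)
    · exact hne hlb
  | .always, _ => exact (mem_timeSem_always_iff hI).trans forall_eq
  | .eventually, hτ => exact absurd rfl hτ
  | .within d, _ => exact mem_timeSem_none_within_iff h hI
  | .for d, _ =>
    exact (mem_timeSem_for_iff_sat hI htr).trans
      (forall₂_congr fun j hj => imp_iff_right (hex j hj))
  | .until stopExpr, _ =>
    exact (mem_timeSem_until_iff_sat hI htr).trans
      (forall₂_congr fun j hj => imp_iff_right (hex j hj))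
  | .before stopExpr, _ =>
    refine (mem_timeSem_before_iff_sat hI htr).trans (forall₂_congr fun j hj => ?_)
    rw [imp_iff_right (hex j hj)]
    exact sat_imp.symm

theorem mem_timeSem_some_iff (h : IsLeftEndpointOn (Sat entails ρ left) I) (hI : I.ub ≤ ρ.last)
    (hτ : τ ≠ .eventually) : I ∈ timeSem entails ρ (some c) res τ ↔
      ∀ j ∈ I, Sat entails ρ (coreFormulaCond c res left τ) j := by
  have htr := h.mem_triggers_some_iff_triggerFormula (c := c) hI
  match τ, hτ with
  | .immediately, _ => exact mem_timeSem_immediately_iff_sat hI htr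
  | .next, _ =>
    refine (mem_timeSem_next_iff_sat hI htr).trans (forall₂_congr fun j hj => ?_)
    simp only [coreFormulaCond, Sat, h.iff_eq j hj]
    tauto
  | .always, _ =>
    exact (mem_timeSem_always_iff_sat hI htr).trans
      (forall₂_congr fun j hj => (h.sat_noTriggers_or_iff hI hj).symm)
  | .eventually, hτ => exact absurd rfl hτ
  | .within d, _ => exact mem_timeSem_some_within_iff h hI
  | .for d, _ =>
    refine (mem_timeSem_for_iff_sat hI htr).trans (forall₂_congr fun j hj => ?_)
    rw [coreFormulaCond, sat_imp, sat_imp, h.sat_noTriggers_or_iff hI hj]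
    exact imp.swap
  | .until stopExpr, _ =>
    exact (mem_timeSem_until_iff_sat hI htr).trans
      (forall₂_congr fun j hj => (h.sat_noTriggers_or_iff hI hj).symm)
  | .before stopExpr, _ =>
    refine (mem_timeSem_before_iff_sat hI htr).trans (forall₂_congr fun j hj => ?_)
    rw [coreFormulaCond, sat_imp, h.sat_noTriggers_or_iff hI hj]
    refine imp_congr_right fun _ => forall_congr' fun ⟨t, ht, htj⟩ => ?_
    have hleft (htrj : ¬ Sat entails ρ (triggerFormula c left) j) : ¬ Sat entails ρ left j := by
      intro hlj
      have heq : t = j := le_antisymm htj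
        (((h.iff_eq j hj).1 hlj).trans_le (mem_of_mem_triggers ht).1)
      exact htrj (heq ▸ ((htr t).1 ht).2)
    exact and_congr_left' (iff_and_self.2 hleft)

end CoreFormula

section BaseForm
variable {AP : Type*} {entails : Set AP → AP → Prop} {ρ : Trace AP} {I : NatInterval}
  {cond : Option (BExpr AP)} {res : BExpr AP} {τ : BasicTiming AP} {left right : MTL AP} {t : ℕ}

theorem mem_timeSem_iff_coreFormula (h : IsLeftEndpointOn (Sat entails ρ left) I)
    (hI : I.ub ≤ ρ.last) (hτ : τ ≠ .eventually) : I ∈ timeSem entails ρ cond res τ ↔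
      ∀ j ∈ I, Sat entails ρ (coreFormula τ cond res left) j := by
  cases cond with
  | none => exact mem_timeSem_none_iff h hI hτ
  | some c => exact mem_timeSem_some_iff h hI hτ

theorem mem_timeSem_eventually_iff_coreFormula (h : IsLeftEndpointOn (Sat entails ρ left) I)
    (hI : I.ub ≤ ρ.last) : I ∈ timeSem entails ρ cond res .eventually ↔
      Sat entails ρ (coreFormula .eventually cond res left) I.ub := by
  cases cond with
  | none =>
    exact (mem_timeSem_eventually_iff_sat (cond := none) hI h.mem_singleton_iff).trans
      (imp_iff_right ⟨I.lb, rfl, I.le⟩)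
  | some c =>
    exact (mem_timeSem_eventually_iff_sat hI (h.mem_triggers_some_iff_triggerFormula hI)).trans
      (h.sat_noTriggers_or_iff hI I.ub_mem).symm

theorem baseForm_of_ne (hτ : τ ≠ .eventually) : baseForm τ cond res left right =
    .imp right (.prev (.sio (coreFormula τ cond res left) left)) := by
  cases τ <;> first | rfl | exact absurd rfl hτ

theorem baseFormLast_of_ne (hτ : τ ≠ .eventually) :
    baseFormLast τ cond res left = .sio (coreFormula τ cond res left) left := by
  cases τ <;> first | rfl | exact absurd rfl hτ

theorem mem_timeSem_iff_baseFormLast (h : IsLeftEndpointOn (Sat entails ρ left) I)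
    (hI : I.ub ≤ ρ.last) : I ∈ timeSem entails ρ cond res τ ↔
      Sat entails ρ (baseFormLast τ cond res left) I.ub := by
  by_cases hτ : τ = .eventually
  · subst hτ
    rw [mem_timeSem_eventually_iff_coreFormula h hI, baseFormLast, sat_imp,
      imp_iff_right h.sat_once_ub]
  · rw [mem_timeSem_iff_coreFormula h hI hτ, baseFormLast_of_ne hτ, h.sio_ub_iff]

theorem sat_imp_prev_succ {φ : MTL AP} (hright : Sat entails ρ right (t + 1)) :
    Sat entails ρ (.imp right (.prev φ)) (t + 1) ↔ Sat entails ρ φ t := by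
  rw [sat_imp, imp_iff_right hright]
  exact and_iff_right t.succ_ne_zero

theorem sat_baseForm_succ (hright : Sat entails ρ right (t + 1))
    (hleft : Sat entails ρ (.once none left) t) :
    Sat entails ρ (baseForm τ cond res left right) (t + 1) ↔
      Sat entails ρ (baseFormLast τ cond res left) t := by
  by_cases hτ : τ = .eventually
  · subst hτ
    rw [baseForm, baseFormLast, sat_imp_prev_succ hright, sat_imp, imp_iff_right hleft]
  · rw [baseForm_of_ne hτ, baseFormLast_of_ne hτ, sat_imp_prev_succ hright]

end BaseForm

/-! ### Bodies -/

section Bodies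
variable {AP : Type*} {entails : Set AP → AP → Prop} {ρ : Trace AP} {I : NatInterval}
  {cond : Option (BExpr AP)} {left right : MTL AP} {t : ℕ} {l : List NatInterval} {b : Body AP}

theorem mem_bodySem_iff_bodyBaseLast (h : IsLeftEndpointOn (Sat entails ρ left) I)
    (hI : I.ub ≤ ρ.last) :
    I ∈ bodySem entails ρ cond b ↔ Sat entails ρ (bodyBaseLast cond left b) I.ub := by
  induction b with
  | single τ res => exact mem_timeSem_iff_baseFormLast h hI
  | and b₁ b₂ ih₁ ih₂ => exact and_congr ih₁ ih₂
  | or b₁ b₂ ih₁ ih₂ => exact or_congr ih₁ ih₂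

theorem sat_bodyBase_succ (hright : Sat entails ρ right (t + 1))
    (hleft : Sat entails ρ (.once none left) t) :
    Sat entails ρ (bodyBase cond left right b) (t + 1) ↔
      Sat entails ρ (bodyBaseLast cond left b) t := by
  induction b with
  | single τ res => exact sat_baseForm_succ hright hleft
  | and b₁ b₂ ih₁ ih₂ => exact and_congr ih₁ ih₂
  | or b₁ b₂ ih₁ ih₂ => exact or_congr ih₁ ih₂

theorem sat_bodyBase_of_not_right (hright : ¬ Sat entails ρ right t) :
    Sat entails ρ (bodyBase cond left right b) t := by
  induction b with
  | single τ res => cases τ <;> exact .inl hright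
  | and b₁ b₂ ih₁ ih₂ => exact ⟨ih₁, ih₂⟩
  | or b₁ b₂ ih₁ _ => exact .inl ih₁

theorem sat_bodyBaseLast_of_not_once_left (hleft : ¬ Sat entails ρ (.once none left) t) :
    Sat entails ρ (bodyBaseLast cond left b) t := by
  induction b with
  | single τ res => cases τ <;> exact .inl hleft
  | and b₁ b₂ ih₁ ih₂ => exact ⟨ih₁, ih₂⟩
  | or b₁ b₂ ih₁ _ => exact .inl ih₁

theorem forall_mem_bodySem_iff_of_not_right {E : ℕ → Prop} (hE : ∀ t, ¬ E t)
    (h : IsDelimited (Sat entails ρ left) E ρ.last l) :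
    (∀ I ∈ l, I ∈ bodySem entails ρ cond b) ↔
      Sat entails ρ (bodyBaseLast cond left b) ρ.last := by
  have hmem : ∀ I ∈ l, (I ∈ bodySem entails ρ cond b ↔
      Sat entails ρ (bodyBaseLast cond left b) ρ.last) := by
    intro I hI
    rw [← (h.ub_eq_or I hI).resolve_right (hE _)]
    exact mem_bodySem_iff_bodyBaseLast (h.left I hI) (h.ub_le I hI)
  refine ⟨fun hl => ?_, fun hlast I hI => (hmem I hI).2 hlast⟩
  by_cases honce : Sat entails ρ (.once none left) ρ.last
  · obtain ⟨t, ht, hleft⟩ := sat_once.1 honce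
    obtain ⟨I, hI, -⟩ := h.exists_of_left t ht hleft fun x _ => hE x
    exact (hmem I hI).1 (hl I hI)
  · exact sat_bodyBaseLast_of_not_once_left honce

theorem sat_hist_bodyBase_iff :
    Sat entails ρ (.hist none (.or (bodyBase cond left right b) ftp)) ρ.last ↔
      ∀ t < ρ.last, Sat entails ρ right (t + 1) →
        Sat entails ρ (bodyBase cond left right b) (t + 1) := by
  constructor
  · exact fun hhist t ht _ =>
      (hhist (t + 1) ⟨ht, trivial⟩).resolve_right fun hftp => t.succ_ne_zero (sat_ftp.1 hftp)
  · rintro hsucc t ⟨ht, -⟩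
    by_cases hright : Sat entails ρ right t
    · rcases t with _ | t
      · exact .inr (sat_ftp.2 rfl)
      · exact .inl (hsucc t ht hright)
    · exact .inl (sat_bodyBase_of_not_right hright)

theorem forall_mem_bodySem_iff_of_right
    (h : IsDelimited (Sat entails ρ left) (Sat entails ρ right) ρ.last l) :
    (∀ I ∈ l, I ∈ bodySem entails ρ cond b) ↔
      Sat entails ρ (.and (.hist none (.or (bodyBase cond left right b) ftp))
        (.imp (.sir (.not right) left) (bodyBaseLast cond left b))) ρ.last := by
  have hmem : ∀ I ∈ l, (I ∈ bodySem entails ρ cond b ↔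
      Sat entails ρ (bodyBaseLast cond left b) I.ub) :=
    fun I hI => mem_bodySem_iff_bodyBaseLast (h.left I hI) (h.ub_le I hI)
  have hsucc : ∀ I ∈ l, Sat entails ρ right (I.ub + 1) →
      (I ∈ bodySem entails ρ cond b ↔
        Sat entails ρ (bodyBase cond left right b) (I.ub + 1)) := fun I hI hright =>
    (hmem I hI).trans (sat_bodyBase_succ hright (h.left I hI).sat_once_ub).symm
  refine Iff.trans ?_
    (and_congr sat_hist_bodyBase_iff (sat_imp.trans (imp_congr_left sat_sir))).symm
  constructor
  · refine fun hl => ⟨fun t ht hright => ?_, ?_⟩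
    · obtain ⟨I, hI, rfl⟩ := h.exists_of_right t ht hright
      exact (hsucc I hI hright).1 (hl I hI)
    · rintro ⟨t, ht, hleft, hnot⟩
      obtain ⟨I, hI, hub⟩ := h.exists_of_left t ht hleft hnot
      exact hub ▸ (hmem I hI).1 (hl I hI)
  · rintro ⟨hbase, hlast⟩ I hI
    by_cases hub : I.ub = ρ.last
    · rw [hmem I hI, hub]
      exact hlast ⟨I.lb, hub ▸ I.le, (h.left I hI).lb,
        fun x hx => h.not_right I hI x ⟨hx.1, hx.2.trans_eq hub.symm⟩⟩
    · have hright := (h.ub_eq_or I hI).resolve_left hub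
      exact (hsucc I hI hright).2 (hbase I.ub ((h.ub_le I hI).lt_of_ne hub) hright)

end Bodies

end Fret

theorem mainTheorem1 {AP : Type*} (entails : Set AP → AP → Prop)
    (r : Fret.Requirement AP) (ρ : Fret.Trace AP) :
    ρ ∈ Fret.fretSem entails r ↔ Fret.Models entails ρ (Fret.genform r) := by
  have h := Fret.isDelimited_scopeSem (entails := entails) (ρ := ρ) r.scope
  rw [Fret.Models, Fret.genform]
  split
  · next hr => exact Fret.forall_mem_bodySem_iff_of_not_right (by simp [Fret.Scope.RightSat, hr]) h
  · next right hr =>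
    exact Fret.forall_mem_bodySem_iff_of_right
      (h.congr (fun _ => Iff.rfl) (by simp [Fret.Scope.RightSat, hr]))
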